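/- A word $w_1\cdots w_m$ over the positive integers contains a pattern $p_1\cdots p_k$ if there are indices $i_1<\dots<i_k$ such that, for all $r,s$, $w_{i_r}<w_{i_s}$ if and only if $p_r<p_s$, and $w_{i_r}=w_{i_s}$ if and only if $p_r=p_s$; otherwise $w$ avoids $p$. Let $\mathcal S_n$ be the set of permutations of $\{1,\dots,n\}$, written as words. A nonnesting permutation of the multiset $\{1,1,2,2,\dots,n,n\}$ is a permutation of this multiset that avoids $1221$ and $2112$. For a set $\Lambda$ of patterns let $c_n(\Lambda)$ be the number of nonnesting permutations of $\{1,1,\dots,n,n\}$ that avoid all patterns in $\Lambda$, and for $\Sigma\subseteq\mathcal S_3$ let $s_n(\Sigma)$ be the number of permutations in $\mathcal S_n$ that avoid all patterns in $\Sigma$. Let $C_n=\frac1{n+1}\binom{2n}{n}$ be the $n$th Catalan number, and let $F_n$ be the Fibonacci numbers with $F_0=F_1=1$ and $F_{n}=F_{n-1}+F_{n-2}$ for $n\ge 2$. **Theorem.** Let $n\ge 1$. For every $\Sigma\subseteq\mathcal S_3$, $$c_n(\{\sigma_1\sigma_2\sigma_2\sigma_3:\sigma\in\Sigma\})=s_n(\Sigma)\,C_n.$$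 Moreover: (a) $c_n(ijjk)=C_n^2$ for every $ijk\in\mathcal S_3$; (b) $c_n(1223,1332)=c_n(1332,2113)=c_n(1332,2331)=c_n(1332,3112)=2^{n-1}C_n$; (c) $c_n(1223,2331)=\left(\binom n2+1\right)C_n$; (d) $c_n(1223,1332,2113)=F_nC_n$; (e) $c_n(1223,1332,2331)=c_n(1332,2113,2331)=c_n(1223,1332,3112)=c_n(1223,2331,3112)=nC_n=\binom{2n}{n-1}$. -/

import Mathlib

namespace NonnestingPattern

/-- Words over the positive integers are lists of natural numbers. `Contains w p`: some subsequence
of `w` (selected by a strictly increasing choice `f` of positions) is in the same relative order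
as the pattern `p`. -/
def Contains (w p : List ℕ) : Prop :=
  ∃ f : Fin p.length → Fin w.length, StrictMono f ∧
    ∀ r s : Fin p.length,
      (w.get (f r) < w.get (f s) ↔ p.get r < p.get s) ∧
      (w.get (f r) = w.get (f s) ↔ p.get r = p.get s)

/-- The word `w` avoids the pattern `p`. -/
def Avoids (w p : List ℕ) : Prop := ¬ Contains w p

/-- `Perms n` is the set of permutations of `{1, …, n}`, in one-line notation. -/
def Perms (n : ℕ) : Set (List ℕ) :=
  {w | w.Perm (List.range' 1 n)}

/-- The set of permutations of the multiset `{1, 1, 2, 2, …, n, n}`. -/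
def DoublePerms (n : ℕ) : Set (List ℕ) :=
  {w | w.Perm (List.range' 1 n ++ List.range' 1 n)}

/-- The nonnesting permutations of `{1, 1, 2, 2, …, n, n}`. -/
def Nonnesting (n : ℕ) : Set (List ℕ) :=
  {w | w ∈ DoublePerms n ∧ Avoids w [1, 2, 2, 1] ∧ Avoids w [2, 1, 1, 2]}

/-- The permutations of `{1, …, n}` avoiding every pattern in `P`. -/
def PermsAvoiding (n : ℕ) (P : Set (List ℕ)) : Set (List ℕ) :=
  {w | w ∈ Perms n ∧ ∀ p ∈ P, Avoids w p}

/-- The nonnesting permutations of `{1, 1, …, n, n}` avoiding every pattern in `P`. -/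
def NonnestingAvoiding (n : ℕ) (P : Set (List ℕ)) : Set (List ℕ) :=
  {w | w ∈ Nonnesting n ∧ ∀ p ∈ P, Avoids w p}

theorem finite_setOf_perm (l : List ℕ) : {w : List ℕ | w.Perm l}.Finite := by
  refine (List.finite_toSet l.permutations).subset ?_
  intro w hw
  exact List.mem_permutations.2 hw

/-- The sets that are counted are finite, so that `Set.ncard` is their genuine cardinality. -/
theorem finite_permsAvoiding (n : ℕ) (P : Set (List ℕ)) : (PermsAvoiding n P).Finite :=
  (finite_setOf_perm _).subset fun _ hw => hw.1

theorem finite_nonnestingAvoiding (n : ℕ) (P : Set (List ℕ)) : (NonnestingAvoiding n P).Finite :=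
  (finite_setOf_perm _).subset fun _ hw => hw.1.1

/-- The number of permutations of `{1, …, n}` avoiding every pattern in `P`. -/
noncomputable def s (n : ℕ) (P : Set (List ℕ)) : ℕ := (PermsAvoiding n P).ncard

/-- The number of nonnesting permutations of `{1, 1, …, n, n}` avoiding every pattern in `P`. -/
noncomputable def c (n : ℕ) (P : Set (List ℕ)) : ℕ := (NonnestingAvoiding n P).ncard

/-- The set of patterns `σ₁σ₂σ₂σ₃` for `σ = σ₁σ₂σ₃` in `S`. -/
def doubleMiddle (S : Set (List ℕ)) : Set (List ℕ) :=
  {p | ∃ i j k : ℕ, [i, j, k] ∈ S ∧ p = [i, j, j, k]}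

end NonnestingPattern

/-!
In a nonnesting permutation of `{1, 1, …, n, n}` the first copies and the second copies of the
letters come in the same order: both form the same permutation `π` of `{1, …, n}`. Read from left
to right it records a run of a queue, where the first copy of a letter is pushed and the second
copy is popped (`QueueWord`), so it is the same as `π` together with a sequence of `n` pushes and
`n` pops that never pops an empty queue. Each `π` occurs with `catalan n` such sequences
(`ncard_queueWord`, `ballot_zero_left`). Some copy of `x` comes before both copies of `y` exactly
when `x` precedes `y` in `π`, and some copy of `z` comes after both copies of `y` exactly when `z`
follows `y` in `π`; hence `x y y z` occurs in the word exactly when `x y z` occurs in `π`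
(`QueueOrdered.doubled_sublist_iff`). This gives `c n (doubleMiddle S) = s n S * catalan n`
(`c_doubleMiddle`), and it remains to count the permutations that avoid the sets of patterns of
length three in question.

These are counted by generating trees: a permutation of `{1, …, n + 1}` that avoids `P` comes from
one of `{1, …, n}` by insertion of the letter `n + 1`, so `L ++ R` has as children the words
`L ++ (n + 1) :: R`. Since the new letter is the largest, each pattern turns into a simple condition on
the pair `L`, `R` (the lemmas `avoids_insert_*`): `L` or `R` is monotone, or all letters of `L`
lie on one side of those of `R`. For each set of patterns a label of the permutation determines
the labels of its children, and the number of descendants satisfies a recurrence that is solved in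
closed form (`IsGeneratingTree`, `IsGeneratingTree.s_eq`). For `123` and `213` the label is the
length of the initial monotone run, and the recurrence is that of the ballot numbers, which also
count the runs of a queue. Reversal and complementation carry the remaining sets of patterns to
those whose trees are treated.
-/

namespace NonnestingPattern

open List

/-! ### Patterns as sublists -/

theorem contains_three_iff {w : List ℕ} {i j k : ℕ} :
    Contains w [i, j, k] ↔ ∃ x y z, [x, y, z] <+ w ∧ ((x < y ↔ i < j) ∧ (y < x ↔ j < i)) ∧
      ((y < z ↔ j < k) ∧ (z < y ↔ k < j)) ∧ ((x < z ↔ i < k) ∧ (z < x ↔ k < i)) := by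
  constructor
  · rintro ⟨f, hf, h⟩
    refine ⟨w[f 0], w[f 1], w[f 2], ?_, ⟨(h 0 1).1, (h 1 0).1⟩, ⟨(h 1 2).1, (h 2 1).1⟩,
      ⟨(h 0 2).1, (h 2 0).1⟩⟩
    have : [f 0, f 1, f 2].Pairwise (· < ·) := by
      simpa using ⟨⟨hf (by decide : (0 : Fin 3) < 1), hf (by decide : (0 : Fin 3) < 2)⟩,
        hf (by decide : (1 : Fin 3) < 2)⟩
    simpa using map_getElem_sublist this
  · rintro ⟨x, y, z, hw, hxy, hyz, hxz⟩
    obtain ⟨is, his, hlt⟩ := sublist_eq_map_getElem hw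
    match is, his, hlt with
    | [a, b, c], his, hlt =>
      simp only [map_cons, map_nil, cons.injEq, and_true] at his
      obtain ⟨rfl, rfl, rfl⟩ := his
      simp only [pairwise_cons, mem_cons, not_mem_nil, or_false, forall_eq_or_imp,
        forall_eq] at hlt
      refine ⟨fun r => [a, b, c].get r, ?_, ?_⟩
      · refine Fin.strictMono_iff_lt_succ.2 fun r => ?_
        fin_cases r
        · exact hlt.1.1
        · exact hlt.2.1
      · intro r s
        simp only [Fin.getElem_fin] at hxy hyz hxz
        fin_cases r <;> fin_cases s <;> simp <;> omega

theorem contains_doubled_iff {w : List ℕ} {i j k : ℕ} :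
    Contains w [i, j, j, k] ↔ ∃ x y z, [x, y, y, z] <+ w ∧ ((x < y ↔ i < j) ∧ (y < x ↔ j < i)) ∧
      ((y < z ↔ j < k) ∧ (z < y ↔ k < j)) ∧ ((x < z ↔ i < k) ∧ (z < x ↔ k < i)) := by
  constructor
  · rintro ⟨f, hf, h⟩
    refine ⟨w[f 0], w[f 1], w[f 3], ?_, ⟨(h 0 1).1, (h 1 0).1⟩, ⟨(h 1 3).1, (h 3 1).1⟩,
      ⟨(h 0 3).1, (h 3 0).1⟩⟩
    have : [f 0, f 1, f 2, f 3].Pairwise (· < ·) := by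
      simpa using ⟨⟨hf (by decide : (0 : Fin 4) < 1), hf (by decide : (0 : Fin 4) < 2),
        hf (by decide : (0 : Fin 4) < 3)⟩, ⟨hf (by decide : (1 : Fin 4) < 2),
        hf (by decide : (1 : Fin 4) < 3)⟩, hf (by decide : (2 : Fin 4) < 3)⟩
    have h12 : w[f 1] = w[f 2] := (h 1 2).2.2 rfl
    have hs := map_getElem_sublist this
    simp only [map_cons, map_nil] at hs
    rwa [← h12] at hs
  · rintro ⟨x, y, z, hw, hxy, hyz, hxz⟩
    obtain ⟨is, his, hlt⟩ := sublist_eq_map_getElem hw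
    have hlen := congrArg length his
    match is, his, hlt, hlen with
    | [a, b, b', c], his, hlt, _ =>
      simp only [map_cons, map_nil, cons.injEq, and_true] at his
      obtain ⟨rfl, rfl, hb, rfl⟩ := his
      simp only [pairwise_cons, mem_cons, not_mem_nil, or_false, forall_eq_or_imp,
        forall_eq] at hlt
      refine ⟨fun r => [a, b, b', c].get r, ?_, ?_⟩
      · refine Fin.strictMono_iff_lt_succ.2 fun r => ?_
        fin_cases r
        · exact hlt.1.1
        · exact hlt.2.1.1
        · exact hlt.2.2.1
      · intro r s
        simp only [Fin.getElem_fin] at hb hxy hyz hxz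
        fin_cases r <;> fin_cases s <;> simp <;> omega

theorem contains_three_mono {v w : List ℕ} {i j k : ℕ} (h : v <+ w) (hv : Contains v [i, j, k]) :
    Contains w [i, j, k] := by
  obtain ⟨x, y, z, hs, ho⟩ := contains_three_iff.1 hv
  exact contains_three_iff.2 ⟨x, y, z, hs.trans h, ho⟩

theorem mem_perms_three {p : List ℕ} (h : p ∈ Perms 3) :
    ∃ i j k, p = [i, j, k] ∧ i ≠ j ∧ j ≠ k ∧ i ≠ k := by
  have hl : p.length = 3 := h.length_eq
  have hn : p.Nodup := h.nodup_iff.2 nodup_range'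
  match p, hl, hn with
  | [i, j, k], _, hn =>
    simp only [nodup_cons, mem_cons, not_mem_nil, or_false, not_or] at hn
    exact ⟨i, j, k, rfl, hn.1.1, hn.2.1, hn.1.2⟩

theorem Perms.nodup {n : ℕ} {w : List ℕ} (h : w ∈ Perms n) : w.Nodup :=
  h.nodup_iff.2 nodup_range'

theorem Perms.length_eq {n : ℕ} {w : List ℕ} (h : w ∈ Perms n) : w.length = n := by
  simpa using List.Perm.length_eq h

theorem Perms.le {n : ℕ} {w : List ℕ} (h : w ∈ Perms n) {x : ℕ} (hx : x ∈ w) : x ≤ n := by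
  have := h.mem_iff.1 hx
  simp only [mem_range'_1] at this
  omega

/-! ### Symmetries -/

theorem contains_three_reverse {w : List ℕ} {i j k : ℕ} :
    Contains w.reverse [i, j, k] ↔ Contains w [k, j, i] := by
  simp only [contains_three_iff]
  constructor
  · rintro ⟨x, y, z, hs, h1, h2, h3⟩
    refine ⟨z, y, x, ?_, ⟨h2.2, h2.1⟩, ⟨h1.2, h1.1⟩, h3.2, h3.1⟩
    simpa using hs.reverse
  · rintro ⟨x, y, z, hs, h1, h2, h3⟩
    refine ⟨z, y, x, ?_, ⟨h2.2, h2.1⟩, ⟨h1.2, h1.1⟩, h3.2, h3.1⟩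
    simpa using hs.reverse

theorem reverse_mem_perms {n : ℕ} {w : List ℕ} (h : w ∈ Perms n) : w.reverse ∈ Perms n :=
  (reverse_perm w).trans h

/-- The complement of a word over `{1, …, n}`: every letter `x` becomes `n + 1 - x`. -/
def compl (n : ℕ) (w : List ℕ) : List ℕ := w.map (n + 1 - ·)

theorem compl_compl {n : ℕ} {w : List ℕ} (h : w ∈ Perms n) : compl n (compl n w) = w := by
  simp only [compl, map_map]
  conv_rhs => rw [← map_id w]
  refine map_congr_left fun x hx => ?_
  have := Perms.le h hx
  simp
  omega

theorem compl_mem_perms {n : ℕ} {w : List ℕ} (h : w ∈ Perms n) : compl n w ∈ Perms n := by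
  refine (Perm.map (n + 1 - ·) h).trans ?_
  refine (perm_ext_iff_of_nodup ?_ nodup_range').2 fun x => ?_
  · refine (nodup_range' (s := 1) (n := n)).map_on fun x hx y hy hxy => ?_
    simp only [mem_range'_1] at hx hy
    omega
  · simp only [mem_map, mem_range'_1]
    constructor
    · rintro ⟨y, hy, rfl⟩
      omega
    · intro hx
      exact ⟨n + 1 - x, by omega, by omega⟩

theorem contains_three_of_compl {n : ℕ} {w : List ℕ} (hw : w ∈ Perms n) {i j k i' j' k' : ℕ}
    (h12 : (i < j ↔ j' < i') ∧ (j < i ↔ i' < j')) (h23 : (j < k ↔ k' < j') ∧ (k < j ↔ j' < k'))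
    (h13 : (i < k ↔ k' < i') ∧ (k < i ↔ i' < k')) (h : Contains w [i, j, k]) :
    Contains (compl n w) [i', j', k'] := by
  obtain ⟨x, y, z, hs, h1, h2, h3⟩ := contains_three_iff.1 h
  have hx := Perms.le hw (hs.subset (by simp : x ∈ [x, y, z]))
  have hy := Perms.le hw (hs.subset (by simp : y ∈ [x, y, z]))
  have hz := Perms.le hw (hs.subset (by simp : z ∈ [x, y, z]))
  refine contains_three_iff.2 ⟨n + 1 - x, n + 1 - y, n + 1 - z, ?_, ?_⟩
  · simpa [compl] using hs.map (n + 1 - ·)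
  · omega

/-- An involution of the permutations of `{1, …, n}` that carries the containment of patterns in
`P` to the containment of patterns in `Q` preserves the number of avoiding permutations. -/
theorem s_eq_of_involution {n : ℕ} {P Q : Set (List ℕ)} (f : List ℕ → List ℕ)
    (hf : ∀ w ∈ Perms n, f w ∈ Perms n) (hff : ∀ w ∈ Perms n, f (f w) = w)
    (h : ∀ w ∈ Perms n, (∀ p ∈ P, Avoids w p) ↔ ∀ q ∈ Q, Avoids (f w) q) : s n P = s n Q := by
  have : PermsAvoiding n Q = f '' PermsAvoiding n P := by
    ext w
    constructor
    · rintro ⟨hw, hq⟩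
      refine ⟨f w, ⟨hf w hw, (h _ (hf w hw)).2 ?_⟩, hff w hw⟩
      rwa [hff w hw]
    · rintro ⟨v, ⟨hv, hp⟩, rfl⟩
      exact ⟨hf v hv, (h v hv).1 hp⟩
  rw [s, s, this, Set.InjOn.ncard_image]
  intro v hv w hw hvw
  rw [← hff v hv.1, ← hff w hw.1, hvw]

theorem s_eq_of_reverse {n : ℕ} {P Q : Set (List ℕ)}
    (h : ∀ w, (∀ p ∈ P, Avoids w p) ↔ ∀ q ∈ Q, Avoids w.reverse q) : s n P = s n Q :=
  s_eq_of_involution reverse (fun _ => reverse_mem_perms) (fun w _ => reverse_reverse w)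
    fun w _ => h w

theorem s_eq_of_compl {n : ℕ} {P Q : Set (List ℕ)}
    (h : ∀ w ∈ Perms n, (∀ p ∈ P, Avoids w p) ↔ ∀ q ∈ Q, Avoids (compl n w) q) : s n P = s n Q :=
  s_eq_of_involution (compl n) (fun _ => compl_mem_perms) (fun _ => compl_compl) h

theorem avoids_compl {n : ℕ} {w : List ℕ} (hw : w ∈ Perms n) {i j k i' j' k' : ℕ}
    (h12 : (i < j ↔ j' < i') ∧ (j < i ↔ i' < j')) (h23 : (j < k ↔ k' < j') ∧ (k < j ↔ j' < k'))
    (h13 : (i < k ↔ k' < i') ∧ (k < i ↔ i' < k')) :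
    Avoids (compl n w) [i', j', k'] ↔ Avoids w [i, j, k] := by
  refine not_congr ⟨fun h => ?_, contains_three_of_compl hw h12 h23 h13⟩
  have := contains_three_of_compl (compl_mem_perms hw) (i' := i) (j' := j) (k' := k)
    (by omega) (by omega) (by omega) h
  rwa [compl_compl hw] at this

theorem avoids_reverse {w : List ℕ} {i j k : ℕ} :
    Avoids w.reverse [i, j, k] ↔ Avoids w [k, j, i] :=
  not_congr contains_three_reverse

/-! ### Ballot numbers -/

/-- Ballot numbers: `ballot k m` is the number of sequences of `m` pushes and `m + k` pops that
start from a queue of length `k`; also the number of nodes at depth `m` below a node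
labelled `k` in the generating tree whose rule is `(k) → (1), (2), …, (k + 1)`. -/
def ballot : ℕ → ℕ → ℕ
  | _, 0 => 1
  | k, m + 1 => ∑ j ∈ Finset.range (k + 1), ballot (j + 1) m

theorem ballot_zero_right (k : ℕ) : ballot k 0 = 1 := by rw [ballot]

theorem ballot_succ (k m : ℕ) :
    ballot k (m + 1) = ∑ j ∈ Finset.range (k + 1), ballot (j + 1) m := by rw [ballot]

theorem ballot_zero_succ (m : ℕ) : ballot 0 (m + 1) = ballot 1 m := by simp [ballot_succ]

theorem ballot_succ_succ (k m : ℕ) :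
    ballot (k + 1) (m + 1) = ballot k (m + 1) + ballot (k + 2) m := by
  rw [ballot_succ, Finset.sum_range_succ, ← ballot_succ]

/-- The reflection formula `ballot k m = (2m+k choose m) - (2m+k choose m-1)`. -/
theorem ballot_add_choose (m k : ℕ) :
    ballot k (m + 1) + (2 * m + 2 + k).choose m = (2 * m + 2 + k).choose (m + 1) := by
  induction m generalizing k with
  | zero =>
    induction k with
    | zero => simp [ballot_zero_succ, ballot_zero_right]
    | succ k ih =>
      simp only [ballot_succ_succ, ballot_zero_right, Nat.choose_zero_right, zero_add,
        Nat.choose_one_right] at ih ⊢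
      omega
  | succ m ihm =>
    induction k with
    | zero =>
      have h := ihm 1
      have h1 := Nat.choose_succ_succ (2 * m + 3) m
      have h2 := Nat.choose_succ_succ (2 * m + 3) (m + 1)
      have h3 : (2 * m + 3).choose (m + 2) = (2 * m + 3).choose (m + 1) :=
        Nat.choose_symm_of_eq_add (by omega)
      rw [ballot_zero_succ, show 2 * (m + 1) + 2 + 0 = 2 * m + 3 + 1 by ring]
      rw [show 2 * m + 2 + 1 = 2 * m + 3 by ring] at h
      simp only [Nat.succ_eq_add_one, add_assoc, Nat.reduceAdd] at *
      omega
    | succ k ihk =>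
      have h := ihm (k + 2)
      have h1 := Nat.choose_succ_succ (2 * m + 4 + k) m
      have h2 := Nat.choose_succ_succ (2 * m + 4 + k) (m + 1)
      rw [ballot_succ_succ, show 2 * (m + 1) + 2 + (k + 1) = 2 * m + 4 + k + 1 by ring]
      rw [show 2 * m + 2 + (k + 2) = 2 * m + 4 + k by ring] at h
      rw [show 2 * (m + 1) + 2 + k = 2 * m + 4 + k by ring] at ihk
      simp only [Nat.succ_eq_add_one] at *
      omega

theorem ballot_zero_left (m : ℕ) : ballot 0 m = catalan m := by
  cases m with
  | zero => simp [ballot_zero_right]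
  | succ m =>
    have h := ballot_add_choose m 0
    have h1 := Nat.choose_succ_right_eq (2 * m + 2) m
    have h2 := succ_mul_catalan_eq_centralBinom (m + 1)
    rw [Nat.centralBinom, show 2 * (m + 1) = 2 * m + 2 by ring] at h2
    rw [show 2 * m + 2 - m = m + 2 by omega] at h1
    rw [add_zero] at h
    refine Nat.eq_of_mul_eq_mul_left (show 0 < m + 1 + 1 by omega) ?_
    nlinarith

theorem mul_catalan_eq_choose {n : ℕ} (hn : 1 ≤ n) :
    n * catalan n = (2 * n).choose (n - 1) := by
  obtain ⟨m, rfl⟩ := Nat.exists_eq_add_of_le' hn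
  have h1 := Nat.choose_succ_right_eq (2 * m + 2) m
  have h2 := succ_mul_catalan_eq_centralBinom (m + 1)
  rw [Nat.centralBinom, show 2 * (m + 1) = 2 * m + 2 by ring] at h2
  rw [show 2 * m + 2 - m = m + 2 by omega, ← h2] at h1
  rw [show 2 * (m + 1) = 2 * m + 2 by ring, Nat.add_sub_cancel]
  refine Nat.eq_of_mul_eq_mul_left (show 0 < m + 2 by omega) ?_
  linarith

/-! ### Two-letter sublists -/

theorem pair_sublist_or {l : List ℕ} {x y : ℕ} (hx : x ∈ l) (hy : y ∈ l) (hxy : x ≠ y) :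
    [x, y] <+ l ∨ [y, x] <+ l := by
  obtain ⟨A, B, rfl⟩ := append_of_mem hx
  rcases mem_append.1 hy with h | h
  · exact .inr ((singleton_sublist.2 h).append (singleton_sublist.2 mem_cons_self))
  · refine .inl (Sublist.trans ?_ (sublist_append_right A _))
    exact (singleton_sublist.2 ((mem_cons.1 h).resolve_left (Ne.symm hxy))).cons_cons x

theorem Nodup.triple_sublist {l : List ℕ} (hl : l.Nodup) {x y z : ℕ} (hxy : [x, y] <+ l)
    (hyz : [y, z] <+ l) : [x, y, z] <+ l := by
  obtain ⟨A, B, rfl⟩ := append_of_mem (hxy.subset (by simp : y ∈ [x, y]))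
  obtain ⟨hA, hB⟩ : y ∉ A ∧ y ∉ B := by
    simp only [nodup_append, nodup_cons, mem_cons] at hl
    exact ⟨fun h => hl.2.2 y h y (.inl rfl) rfl, hl.2.1.1⟩
  have hx : x ∈ A := by
    obtain ⟨l₁, l₂, h, h₁, h₂⟩ := sublist_append_iff.1 hxy
    rcases cons_eq_append_iff.1 h with ⟨rfl, rfl⟩ | ⟨l', rfl, -⟩
    · rcases sublist_cons_iff.1 h₂ with h₂ | ⟨r, hr, h₂⟩
      · exact absurd (h₂.subset (by simp)) hB
      · simp only [cons.injEq] at hr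
        obtain ⟨-, rfl⟩ := hr
        exact absurd (h₂.subset (by simp)) hB
    · exact h₁.subset (by simp)
  have hz : z ∈ B := by
    obtain ⟨l₁, l₂, h, h₁, h₂⟩ := sublist_append_iff.1 hyz
    rcases cons_eq_append_iff.1 h with ⟨rfl, rfl⟩ | ⟨l', rfl, -⟩
    · rcases sublist_cons_iff.1 h₂ with h₂ | ⟨r, hr, h₂⟩
      · exact absurd (h₂.subset (by simp)) hB
      · simp only [cons.injEq] at hr
        obtain ⟨-, rfl⟩ := hr
        exact h₂.subset (by simp)
    · exact absurd (h₁.subset (by simp)) hA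
  exact (singleton_sublist.2 hx).append ((singleton_sublist.2 hz).cons_cons y)

theorem mem_or_pair_sublist_of_count {A B : List ℕ} {x y : ℕ} (hxy : x ≠ y)
    (h : (A ++ y :: B).count x = 2) : x ∈ A ∨ [y, x, x] <+ A ++ y :: B := by
  by_cases hx : x ∈ A
  · exact .inl hx
  · rw [count_append, count_eq_zero.2 hx, zero_add, count_cons_of_ne hxy.symm] at h
    have : [x, x] <+ B := by simpa using replicate_sublist_iff.2 h.ge
    exact .inr ((this.cons_cons y).trans (sublist_append_right A _))

theorem mem_or_sublist_pair_of_count {A B : List ℕ} {x y : ℕ} (hxy : x ≠ y)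
    (h : (A ++ y :: B).count x = 2) : x ∈ B ∨ [x, x, y] <+ A ++ y :: B := by
  by_cases hx : x ∈ B
  · exact .inl hx
  · rw [count_append, count_cons_of_ne hxy.symm, count_eq_zero.2 hx, add_zero] at h
    have : [x, x] <+ A := by simpa using replicate_sublist_iff.2 h.ge
    exact .inr (this.append (singleton_sublist.2 mem_cons_self))

/-- If `x` precedes `y` in the order of last occurrences, then the last `y` of the word comes after
every `x`. -/
theorem append_pair_sublist_of_dedup {w : List ℕ} {x y : ℕ} (hxy : [x, y] <+ w.dedup)
    {s : List ℕ} (hs : s ++ [x] <+ w) : s ++ [x, y] <+ w := by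
  induction w generalizing s with
  | nil => simp at hs
  | cons c w ih =>
    by_cases hc : c ∈ w
    · rw [dedup_cons_of_mem hc] at hxy
      rcases sublist_cons_iff.1 hs with h | ⟨r, hr, h⟩
      · exact (ih hxy h).cons c
      · rcases append_eq_cons_iff.1 hr with ⟨rfl, hx⟩ | ⟨s', rfl, rfl⟩
        · obtain ⟨rfl, rfl⟩ := cons.inj hx
          exact (ih hxy (s := []) (singleton_sublist.2 hc)).cons x
        · exact (ih hxy h).cons_cons c
    · rw [dedup_cons_of_notMem hc] at hxy
      rcases sublist_cons_iff.1 hxy with hxy' | ⟨r', hr', hxy'⟩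
      · rcases sublist_cons_iff.1 hs with h | ⟨r, hr, h⟩
        · exact (ih hxy' h).cons c
        · rcases append_eq_cons_iff.1 hr with ⟨rfl, hx⟩ | ⟨s', rfl, rfl⟩
          · obtain ⟨rfl, rfl⟩ := cons.inj hx
            exact absurd (mem_dedup.1 (hxy'.subset (by simp : x ∈ [x, y]))) hc
          · exact (ih hxy' h).cons_cons c
      · obtain ⟨rfl, rfl⟩ := cons.inj hr'
        rcases sublist_cons_iff.1 hs with h | ⟨r, hr, h⟩
        · exact absurd (h.subset (by simp)) hc
        · rcases append_eq_cons_iff.1 hr with ⟨rfl, hx⟩ | ⟨s', rfl, rfl⟩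
          · exact (singleton_sublist.2
              (mem_dedup.1 (singleton_sublist.1 hxy'))).cons_cons x
          · exact absurd (h.subset (by simp)) hc

/-! ### Nonnesting permutations as queue words -/

/-- `QueueOrdered π w`: every letter of `π` occurs twice in `w`, and both the first and the second
occurrences of the letters come in the order given by `π`. For `x` before `y` in `π`, the latter
says that the restriction of `w` to `x` and `y` is `xxyy` or `xyxy`. -/
def QueueOrdered (π w : List ℕ) : Prop :=
  w.Perm (π ++ π) ∧ ∀ x y, [x, y] <+ π → ¬ [y, x, x] <+ w ∧ ¬ [y, y, x] <+ w

/-- The runs of a queue: `QueueWord t q w` says that `w` is the record of a sequence of operations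
that pushes the letters of `t` in this order onto a queue with initial content `q` and ends
with the queue empty, where both a push and a pop record the letter concerned. -/
inductive QueueWord : List ℕ → List ℕ → List ℕ → Prop
  | nil : QueueWord [] [] []
  | push {a : ℕ} {t q w : List ℕ} : QueueWord t (q ++ [a]) w → QueueWord (a :: t) q (a :: w)
  | pop {b : ℕ} {t q w : List ℕ} : QueueWord t q w → QueueWord t (b :: q) (b :: w)

theorem QueueWord.perm {t q w : List ℕ} (h : QueueWord t q w) : w.Perm (q ++ t ++ t) := by
  induction h with
  | nil => simp
  | @push a t q w _ ih =>
    refine (ih.cons a).trans (perm_iff_count.2 fun c => ?_)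
    simp only [count_append, count_cons, count_nil]
    omega
  | pop _ ih => exact ih.cons _

theorem QueueWord.dedup_eq {t q w : List ℕ} (h : QueueWord t q w) (hn : (q ++ t).Nodup) :
    w.dedup = q ++ t := by
  induction h with
  | nil => rfl
  | @push a t q w hw ih =>
    have ha : a ∈ w := hw.perm.mem_iff.2 (by simp)
    rw [dedup_cons_of_mem ha, ih (by simpa using hn)]
    simp
  | @pop b t q w hw ih =>
    simp only [cons_append, nodup_cons] at hn
    have hb : b ∉ w := fun h => hn.1 (by simpa using hw.perm.mem_iff.1 h)
    rw [dedup_cons_of_notMem hb, ih hn.2, cons_append]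

/-- The contents of the queue are prepended to the record, so that every letter counts twice. -/
theorem QueueWord.queueOrdered {t q w : List ℕ} (h : QueueWord t q w) (hn : (q ++ t).Nodup) :
    QueueOrdered (q ++ t) (q ++ w) := by
  refine ⟨?_, ?_⟩
  · have := h.perm.append_left q
    refine this.trans ?_
    simp only [append_assoc]
    exact (Perm.append_left q (by simpa using perm_append_comm_assoc q t t))
  induction h with
  | nil => simp
  | @push a t q w hw ih => simpa using ih (by simpa using hn)
  | @pop b t q w hw ih =>
    simp only [cons_append, nodup_cons] at hn
    have hb : b ∉ w := fun h => hn.1 (by simpa using hw.perm.mem_iff.1 h)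
    have hbq : b ∉ q := fun h => hn.1 (by simp [h])
    intro x y hxy
    rcases sublist_cons_iff.1 hxy with hxy | ⟨r, hr, hxy⟩
    · have hx : b ≠ x := fun h => hn.1 (h ▸ hxy.subset (by simp))
      have hy : b ≠ y := fun h => hn.1 (h ▸ hxy.subset (by simp))
      have key : ∀ {l : List ℕ}, b ∉ l → l <+ b :: (q ++ b :: w) → l <+ q ++ w := by
        intro l hl h
        have h' := h.filter (fun c => c ≠ b)
        have e : ∀ {l : List ℕ}, b ∉ l → l.filter (fun c => c ≠ b) = l := fun hl =>
          filter_eq_self.2 fun c hc => by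
            simp only [decide_eq_true_eq]
            exact fun h => hl (h ▸ hc)
        rw [e hl] at h'
        simpa only [filter_append, filter_cons, e hb, e hbq, ne_eq, not_true_eq_false, decide_false,
            Bool.false_eq_true, if_false] using h'
      refine ⟨fun h => (ih hn.2 x y hxy).1 (key (by simp [hx, hy]) h),
        fun h => (ih hn.2 x y hxy).2 (key (by simp [hx, hy]) h)⟩
    · simp only [cons.injEq] at hr
      obtain ⟨rfl, rfl⟩ := hr
      have hy : x ≠ y := fun h => hn.1 (h ▸ hxy.subset (by simp))
      constructor
      · intro h
        have h := (sublist_cons_iff.1 h).resolve_right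
          (fun ⟨r, hr, _⟩ => hy (cons.inj hr).1.symm)
        have := h.count_le x
        simp only [append_eq, count_append, count_cons_self, count_eq_zero.2 hb,
          count_eq_zero.2 hbq, count_cons_of_ne hy.symm, count_nil] at this
        omega
      · intro h
        have h := (sublist_cons_iff.1 h).resolve_right
          (fun ⟨r, hr, _⟩ => hy (cons.inj hr).1.symm)
        obtain ⟨l₁, l₂, e, h₁, h₂⟩ := sublist_append_iff.1 h
        have hl₂ : ∀ s, l₂ ≠ y :: (s ++ [x]) := by
          rintro s rfl
          have h₂ := (sublist_cons_iff.1 h₂).resolve_right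
            (fun ⟨r, hr, _⟩ => hy (cons.inj hr).1.symm)
          exact hb (h₂.subset (by simp))
        rcases l₁ with _ | ⟨a, _ | ⟨a', l⟩⟩
        · exact hl₂ [y] (by simpa using e.symm)
        · simp only [cons_append, nil_append, cons.injEq] at e
          exact hl₂ [] e.2.symm
        · simp only [cons_append, cons.injEq] at e
          obtain ⟨rfl, rfl, -⟩ := e
          have := hn.2.sublist
            ((((nil_sublist l).cons_cons y).cons_cons y).trans h₁ |>.trans
              (sublist_append_left _ _))
          simp at this

/-- Read from left to right, a word ordered by `π` can only push the next letter of `π` or pop the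
head of the queue. -/
theorem QueueOrdered.queueWord {w : List ℕ} : ∀ {t q : List ℕ}, (q ++ t).Nodup →
    QueueOrdered (q ++ t) (q ++ w) → QueueWord t q w := by
  induction w with
  | nil =>
    intro t q _ h
    have hl := h.1.length_eq
    simp only [length_append, length_nil] at hl
    obtain rfl : q = [] := length_eq_zero_iff.1 (by omega)
    obtain rfl : t = [] := length_eq_zero_iff.1 (by omega)
    exact .nil
  | cons c w ih =>
    intro t q hn h
    have hcount : ∀ x ∈ q ++ t, (q ++ c :: w).count x = 2 := fun x hx => by
      rw [h.1.count_eq, count_append, count_eq_one_of_mem hn hx]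
    have hc : c ∈ q ++ t := by
      have : c ∈ q ++ c :: w := by simp
      exact (mem_append.1 (h.1.mem_iff.1 this)).elim id id
    have hn' := nodup_append.1 hn
    by_cases hcq : c ∈ q
    · cases q with
      | nil => simp at hcq
      | cons b q =>
        by_cases hbc : b = c
        · subst hbc
          refine .pop (ih (nodup_cons.1 hn).2 ⟨?_, fun x y hxy => ?_⟩)
          · refine perm_iff_count.2 fun x => ?_
            have := perm_iff_count.1 h.1 x
            simp only [count_append, count_cons] at this ⊢
            omega
          · have hs : q ++ w <+ b :: q ++ b :: w :=
              ((Sublist.refl q).cons b).append ((Sublist.refl w).cons b)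
            have := h.2 x y (hxy.cons b)
            exact ⟨fun h' => this.1 (h'.trans hs), fun h' => this.2 (h'.trans hs)⟩
        · exfalso
          -- a letter in the queue that is not its head cannot be popped
          have hcq' : c ∈ q := (mem_cons.1 hcq).resolve_left (Ne.symm hbc)
          have hbq : b ∉ q := (nodup_cons.1 hn'.1).1
          refine (h.2 b c ?_).2 ?_
          · exact (singleton_sublist.2 (mem_append_left t hcq')).cons_cons b
          · have hbw : b ∈ w := by
              have := hcount b (by simp)
              simp only [cons_append, count_cons_self, count_append, count_eq_zero.2 hbq,
                count_cons_of_ne (Ne.symm hbc)] at this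
              exact count_pos_iff.1 (by omega)
            exact ((singleton_sublist.2 hcq).append
              ((singleton_sublist.2 hbw).cons_cons c))
    · have hct : c ∈ t := (mem_append.1 hc).resolve_left hcq
      cases t with
      | nil => simp at hct
      | cons a t =>
        by_cases hac : a = c
        · subst hac
          refine .push (ih ?_ ?_)
          · simpa using hn
          · simpa using h
        · exfalso
          -- a letter other than the next one cannot be pushed
          have hct' : c ∈ t := (mem_cons.1 hct).resolve_left (Ne.symm hac)
          have haq : a ∉ q := fun ha => hn'.2.2 a ha a (by simp) rfl
          refine (h.2 a c ?_).1 ?_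
          · exact ((singleton_sublist.2 hct').cons_cons a).trans (sublist_append_right q _)
          · have haw : w.count a = 2 := by
              have := hcount a (by simp)
              simpa only [count_append, count_eq_zero.2 haq, zero_add,
                count_cons_of_ne (Ne.symm hac)] using this
            have : [a, a] <+ w := by simpa using replicate_sublist_iff.2 haw.ge
            exact (this.cons_cons c).trans (sublist_append_right q _)

theorem queueWord_iff {π w : List ℕ} (hn : π.Nodup) : QueueWord π [] w ↔ QueueOrdered π w :=
  ⟨fun h => by simpa using h.queueOrdered (by simpa using hn),
    fun h => QueueOrdered.queueWord (q := []) (by simpa using hn) (by simpa using h)⟩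

theorem finite_queueWord (t q : List ℕ) : {w | QueueWord t q w}.Finite :=
  (finite_setOf_perm (q ++ t ++ t)).subset fun _ h => QueueWord.perm h

theorem ncard_queueWord (m : ℕ) : ∀ (t q : List ℕ), (q ++ t).Nodup → t.length = m →
    {w | QueueWord t q w}.ncard = ballot q.length t.length := by
  induction m with
  | zero =>
    intro t q hn ht
    clear hn
    obtain rfl := length_eq_zero_iff.1 ht
    have : {w | QueueWord [] q w} = {q} := by
      ext w
      simp only [Set.mem_ofPred_eq, Set.mem_singleton_iff]
      constructor
      · generalize ht : ([] : List ℕ) = t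
        intro h
        induction h with
        | nil => rfl
        | push _ _ => simp at ht
        | pop _ ih => rw [ih ht]
      · rintro rfl
        induction w with
        | nil => exact .nil
        | cons b w ih => exact .pop ih
    simp [this, ballot_zero_right]
  | succ m ihm =>
    intro t q hn ht
    obtain ⟨a, t, rfl⟩ := exists_cons_of_length_eq_add_one ht
    have ht' : t.length = m := by simpa using ht
    have hpush : ∀ q : List ℕ, (q ++ a :: t).Nodup →
        (cons a '' {w | QueueWord t (q ++ [a]) w}).ncard = ballot (q.length + 1) m := by
      intro q hn
      rw [Set.ncard_image_of_injective _ (cons_injective),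
        ihm t (q ++ [a]) (by simpa using hn) ht', ht']
      simp
    induction q with
    | nil =>
      have : {w | QueueWord (a :: t) [] w} = cons a '' {w | QueueWord t ([] ++ [a]) w} := by
        ext w
        constructor
        · rintro (_ | h | _)
          exact ⟨_, h, rfl⟩
        · rintro ⟨w, h, rfl⟩
          exact .push h
      rw [this, hpush [] hn, ht, length_nil, ballot_zero_succ]
    | cons b q ihq =>
      have hab : a ≠ b := by
        rintro rfl
        simp at hn
      have : {w | QueueWord (a :: t) (b :: q) w} =
          cons b '' {w | QueueWord (a :: t) q w} ∪
            cons a '' {w | QueueWord t (b :: q ++ [a]) w} := by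
        ext w
        constructor
        · rintro (_ | h | h)
          · exact .inr ⟨_, h, rfl⟩
          · exact .inl ⟨_, h, rfl⟩
        · rintro (⟨w, h, rfl⟩ | ⟨w, h, rfl⟩)
          · exact .pop h
          · exact .push h
      rw [this, Set.ncard_union_eq _ ((finite_queueWord _ _).image _)
        ((finite_queueWord _ _).image _), hpush _ hn,
        Set.ncard_image_of_injective _ (cons_injective), ihq (nodup_cons.1 hn).2, ht,
        length_cons, ballot_succ_succ]
      refine Set.disjoint_left.2 ?_
      rintro _ ⟨w, -, rfl⟩ ⟨w', -, h⟩
      exact hab (cons.inj h).1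

theorem count_of_perm_append {π w : List ℕ} (hn : π.Nodup) (h : w.Perm (π ++ π)) {x : ℕ}
    (hx : x ∈ π) : w.count x = 2 := by
  rw [h.count_eq, count_append, count_eq_one_of_mem hn hx]

theorem avoids_nested_iff {w : List ℕ} :
    (Avoids w [1, 2, 2, 1] ∧ Avoids w [2, 1, 1, 2]) ↔
      ∀ x y, x ≠ y → ¬ [x, y, y, x] <+ w := by
  simp only [Avoids, contains_doubled_iff]
  constructor
  · rintro ⟨h1, h2⟩ x y hxy hs
    rcases lt_or_gt_of_ne hxy with h | h
    · exact h1 ⟨x, y, x, hs, by omega⟩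
    · exact h2 ⟨x, y, x, hs, by omega⟩
  · intro h
    constructor
    · rintro ⟨x, y, z, hs, h1, h2, h3⟩
      obtain rfl : x = z := by omega
      exact h x y (by omega) hs
    · rintro ⟨x, y, z, hs, h1, h2, h3⟩
      obtain rfl : x = z := by omega
      exact h x y (by omega) hs

theorem mem_nonnesting_iff {n : ℕ} {w : List ℕ} :
    w ∈ Nonnesting n ↔ w.dedup ∈ Perms n ∧ QueueOrdered w.dedup w := by
  rw [Nonnesting, Set.mem_ofPred_eq, avoids_nested_iff]
  constructor
  · rintro ⟨hw, h⟩
    have hd : w.dedup ∈ Perms n := by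
      refine (perm_ext_iff_of_nodup w.nodup_dedup nodup_range').2 fun x => ?_
      rw [mem_dedup, hw.mem_iff, mem_append, or_self]
    have hp : w.Perm (w.dedup ++ w.dedup) := hw.trans (hd.symm.append hd.symm)
    refine ⟨hd, hp, fun x y hxy => ?_⟩
    have hne : x ≠ y := by simpa using w.nodup_dedup.sublist hxy
    constructor
    · intro hs
      exact h y x hne.symm (append_pair_sublist_of_dedup hxy (s := [y, x]) hs)
    · intro hs
      have := (append_pair_sublist_of_dedup hxy (s := [y, y]) hs).count_le y
      rw [count_of_perm_append w.nodup_dedup hp (hxy.subset (by simp))] at this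
      simp [hne] at this
  · rintro ⟨hd, hp, h⟩
    refine ⟨hp.trans (hd.append hd), fun x y hxy hs => ?_⟩
    have hx : x ∈ w.dedup := mem_dedup.2 (hs.subset (by simp))
    have hy : y ∈ w.dedup := mem_dedup.2 (hs.subset (by simp))
    rcases pair_sublist_or hx hy hxy with h' | h'
    · exact (h x y h').2 ((sublist_cons_self x _).trans hs)
    · exact (h y x h').1 (Sublist.trans (sublist_append_left [x, y, y] [x]) hs)

/-- An occurrence of `x y y z` in a nonnesting permutation is an occurrence of `x y z` in the
permutation that lists its letters in order of appearance. -/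
theorem QueueOrdered.doubled_sublist_iff {π w : List ℕ} (hn : π.Nodup) (h : QueueOrdered π w)
    {x y z : ℕ} (hxy : x ≠ y) (hyz : y ≠ z) :
    [x, y, y, z] <+ w ↔ [x, y, z] <+ π := by
  have hmem : ∀ {a}, a ∈ w → a ∈ π := fun ha => by simpa using h.1.mem_iff.1 ha
  constructor
  · intro hs
    have hx : x ∈ π := hmem (hs.subset (by simp))
    have hy : y ∈ π := hmem (hs.subset (by simp))
    have hz : z ∈ π := hmem (hs.subset (by simp))
    refine Nodup.triple_sublist hn ?_ ?_
    · refine (pair_sublist_or hx hy hxy).resolve_right fun h' => (h.2 y x h').1 ?_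
      exact Sublist.trans (sublist_append_left [x, y, y] [z]) hs
    · refine (pair_sublist_or hy hz hyz).resolve_right fun h' => (h.2 z y h').2 ?_
      exact (sublist_cons_self x _).trans hs
  · intro hs
    have hcx := count_of_perm_append hn h.1 (hs.subset (by simp : x ∈ _))
    have hcy := count_of_perm_append hn h.1 (hs.subset (by simp : y ∈ _))
    have hcz := count_of_perm_append hn h.1 (hs.subset (by simp : z ∈ _))
    have h1 := h.2 x y (Sublist.trans (sublist_append_left [x, y] [z]) hs)
    have h2 := h.2 y z ((sublist_cons_self x _).trans hs)
    have hyy : [y] ++ [y] <+ w := by simpa using replicate_sublist_iff.2 hcy.ge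
    obtain ⟨A, B, rfl, hA, hB⟩ := append_sublist_iff.1 hyy
    obtain ⟨A₁, A₂, rfl⟩ := append_of_mem (singleton_sublist.1 hA)
    obtain ⟨B₁, B₂, rfl⟩ := append_of_mem (singleton_sublist.1 hB)
    have hxA : x ∈ A₁ := by
      simp only [append_assoc, cons_append] at hcx h1
      exact (mem_or_pair_sublist_of_count hxy hcx).resolve_right h1.1
    have hzB : z ∈ B₂ := by
      rw [← append_assoc] at hcz h2
      exact (mem_or_sublist_pair_of_count hyz.symm hcz).resolve_right h2.2
    have e1 : [x, y] <+ A₁ ++ y :: A₂ :=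
      (singleton_sublist.2 hxA).append (singleton_sublist.2 mem_cons_self)
    have e2 : [y, z] <+ B₁ ++ y :: B₂ :=
      ((singleton_sublist.2 hzB).cons_cons y).trans (sublist_append_right B₁ _)
    exact e1.append e2

theorem avoids_doubled_iff {π w : List ℕ} (hn : π.Nodup) (h : QueueOrdered π w) {i j k : ℕ}
    (hij : i ≠ j) (hjk : j ≠ k) : Avoids w [i, j, j, k] ↔ Avoids π [i, j, k] := by
  refine not_congr ?_
  rw [contains_doubled_iff, contains_three_iff]
  refine exists_congr fun x => exists_congr fun y => exists_congr fun z => ?_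
  refine and_congr_left fun ho => h.doubled_sublist_iff hn ?_ ?_ <;> omega

theorem ncard_biUnion_eq_mul {α β : Type*} {T : Set α} (hT : T.Finite) {f : α → Set β} {k : ℕ}
    (hf : ∀ a ∈ T, (f a).Finite) (hd : T.PairwiseDisjoint f) (hk : ∀ a ∈ T, (f a).ncard = k) :
    (⋃ a ∈ T, f a).ncard = T.ncard * k := by
  rw [hT.ncard_biUnion hf hd, finsum_mem_congr rfl hk, finsum_mem_eq_finite_toFinset_sum _ hT,
    Finset.sum_const, Set.ncard_eq_toFinset_card T hT, smul_eq_mul]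

/-- The nonnesting permutations are fibred over the permutations `π` that list their letters in
order of appearance; `π` is recovered from `w` as `w.dedup`. -/
theorem c_doubleMiddle (n : ℕ) {S : Set (List ℕ)} (hS : S ⊆ Perms 3) :
    c n (doubleMiddle S) = s n S * catalan n := by
  have key : NonnestingAvoiding n (doubleMiddle S) =
      ⋃ π ∈ PermsAvoiding n S, {w | QueueWord π [] w} := by
    ext w
    simp only [NonnestingAvoiding, Set.mem_ofPred_eq, mem_nonnesting_iff, Set.mem_iUnion,
      exists_prop]
    constructor
    · rintro ⟨⟨hd, hq⟩, hp⟩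
      refine ⟨w.dedup, ⟨hd, fun p hpS => ?_⟩, (queueWord_iff w.nodup_dedup).2 hq⟩
      obtain ⟨i, j, k, rfl, hij, hjk, -⟩ := mem_perms_three (hS hpS)
      exact (avoids_doubled_iff w.nodup_dedup hq hij hjk).1 (hp _ ⟨i, j, k, hpS, rfl⟩)
    · rintro ⟨π, ⟨hπ, hp⟩, hw⟩
      have hn := Perms.nodup hπ
      obtain rfl : w.dedup = π := by simpa using hw.dedup_eq (by simpa using hn)
      have hq := (queueWord_iff hn).1 hw
      refine ⟨⟨hπ, hq⟩, ?_⟩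
      rintro _ ⟨i, j, k, hpS, rfl⟩
      obtain ⟨i', j', k', e, hij, hjk, -⟩ := mem_perms_three (hS hpS)
      simp only [cons.injEq, and_true] at e
      obtain ⟨rfl, rfl, rfl⟩ := e
      exact (avoids_doubled_iff hn hq hij hjk).2 (hp _ hpS)
  rw [c, key, s, ncard_biUnion_eq_mul (finite_permsAvoiding n S)
    (fun π _ => finite_queueWord π []) _ fun π hπ => ?_]
  · intro π hπ π' hπ' hne
    refine Set.disjoint_left.2 fun w hw hw' => hne ?_
    have h1 := QueueWord.dedup_eq hw (by simpa using Perms.nodup hπ.1)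
    have h2 := QueueWord.dedup_eq hw' (by simpa using Perms.nodup hπ'.1)
    simpa using h1.symm.trans h2
  · rw [ncard_queueWord _ π [] (by simpa using Perms.nodup hπ.1) rfl, Perms.length_eq hπ.1,
      length_nil, ballot_zero_left]

/-! ### Generating trees by insertion of the largest letter -/

theorem filter_mem_perms {n m : ℕ} (hnm : n ≤ m) {v : List ℕ} (hv : v ∈ Perms m) :
    v.filter (· ≤ n) ∈ Perms n := by
  refine (perm_ext_iff_of_nodup ((Perms.nodup hv).filter _) nodup_range').2 fun x => ?_
  rw [mem_filter, hv.mem_iff, mem_range'_1, mem_range'_1, decide_eq_true_eq]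
  omega

theorem filter_eq_self_of_mem_perms {n : ℕ} {w : List ℕ} (hw : w ∈ Perms n) :
    w.filter (· ≤ n) = w :=
  filter_eq_self.2 fun _ hx => decide_eq_true (Perms.le hw hx)

theorem filter_insert_max {n : ℕ} {L R : List ℕ} (hw : L ++ R ∈ Perms n) :
    (L ++ (n + 1) :: R).filter (· ≤ n) = L ++ R := by
  rw [← filter_eq_self_of_mem_perms hw]
  simp

theorem exists_eq_insert_max {n : ℕ} {v : List ℕ} (hv : v ∈ Perms (n + 1)) :
    ∃ L R, v = L ++ (n + 1) :: R ∧ L ++ R = v.filter (· ≤ n) := by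
  have hm : n + 1 ∈ v := hv.mem_iff.2 (by simp)
  obtain ⟨L, R, rfl⟩ := append_of_mem hm
  refine ⟨L, R, rfl, ?_⟩
  have hn := Perms.nodup hv
  rw [nodup_middle, nodup_cons] at hn
  have h : ∀ x ∈ L ++ R, decide (x ≤ n) = true := fun x hx => by
    have := Perms.le hv (x := x) (by simp only [mem_append, mem_cons] at hx ⊢; tauto)
    have : x ≠ n + 1 := fun h => hn.1 (h ▸ hx)
    simp only [decide_eq_true_eq]
    omega
  rw [← filter_eq_self.2 h]
  simp

theorem insert_max_mem_perms {n : ℕ} {L R : List ℕ} (hw : L ++ R ∈ Perms n) :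
    L ++ (n + 1) :: R ∈ Perms (n + 1) := by
  refine perm_middle.trans ((Perm.cons _ hw).trans ?_)
  rw [range'_concat, one_mul, add_comm 1 n]
  exact perm_append_comm (l₁ := [n + 1])

theorem notMem_of_mem_perms {n : ℕ} {w : List ℕ} (hw : w ∈ Perms n) : n + 1 ∉ w := fun h =>
  absurd (Perms.le hw h) (by omega)

/-- The permutations of `{1, …, n + m}` avoiding `P` whose letters up to `n` form the word `w`. -/
def Descendants (P : Set (List ℕ)) (n m : ℕ) (w : List ℕ) : Set (List ℕ) :=
  {v | v ∈ PermsAvoiding (n + m) P ∧ v.filter (· ≤ n) = w}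

theorem finite_descendants (P : Set (List ℕ)) (n m : ℕ) (w : List ℕ) :
    (Descendants P n m w).Finite :=
  (finite_permsAvoiding (n + m) P).subset fun _ h => h.1

/-- `IsGeneratingTree P Lab F`: the permutations avoiding `P`, where the children of a permutation
of `{1, …, n}` come from the insertion of `n + 1`, can be labelled so that the label of a
permutation determines the labels of its children. Here `Lab n q w` says that `w` has the label `q`,
the finite set `A` holds the positions where `n + 1` may be inserted, `g` gives the labels of the
children, and `F q m` satisfies the recurrence for the number of descendants `m` levels below
a node labelled `q`. -/
structure IsGeneratingTree {Q : Type*} (P : Set (List ℕ)) (Lab : ℕ → Q → List ℕ → Prop)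
    (F : Q → ℕ → ℕ) : Prop where
  zero : ∀ q, F q 0 = 1
  step : ∀ n q w, w ∈ PermsAvoiding n P → Lab n q w → ∃ (A : Finset ℕ) (g : ℕ → Q),
    A ⊆ Finset.range (n + 1) ∧
    (∀ L R, L ++ R = w → ((∀ p ∈ P, Avoids (L ++ (n + 1) :: R) p) ↔ L.length ∈ A)) ∧
    (∀ L R, L ++ R = w → L.length ∈ A → Lab (n + 1) (g L.length) (L ++ (n + 1) :: R)) ∧
    ∀ m, ∑ p ∈ A, F (g p) m = F q (m + 1)

theorem IsGeneratingTree.ncard_descendants {Q : Type*} {P : Set (List ℕ)}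
    {Lab : ℕ → Q → List ℕ → Prop} {F : Q → ℕ → ℕ} (h : IsGeneratingTree P Lab F)
    (hP : ∀ p ∈ P, ∃ i j k, p = [i, j, k]) (m : ℕ) :
    ∀ n q w, w ∈ PermsAvoiding n P → Lab n q w → (Descendants P n m w).ncard = F q m := by
  induction m with
  | zero =>
    intro n q w hw _
    have : Descendants P n 0 w = {w} := by
      ext v
      constructor
      · rintro ⟨hv, rfl⟩
        exact (filter_eq_self_of_mem_perms hv.1).symm
      · rintro rfl
        exact ⟨hw, filter_eq_self_of_mem_perms hw.1⟩
    rw [this, Set.ncard_singleton, h.zero]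
  | succ m ih =>
    intro n q w hw hq
    obtain ⟨A, g, hA, hav, hlab, hF⟩ := h.step n q w hw hq
    have hlen : ∀ p ∈ A, (w.take p).length = p := fun p hp => by
      have := Finset.mem_range.1 (hA hp)
      rw [length_take, Perms.length_eq hw.1]
      omega
    have hins : ∀ p ∈ A, w.take p ++ (n + 1) :: w.drop p ∈ PermsAvoiding (n + 1) P :=
      fun p hp => ⟨insert_max_mem_perms (by simpa using hw.1),
        (hav _ _ (take_append_drop p w)).2 (by rwa [hlen p hp])⟩
    have hU : Descendants P n (m + 1) w =
        ⋃ p ∈ (A : Set ℕ), Descendants P (n + 1) m (w.take p ++ (n + 1) :: w.drop p) := by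
      ext v
      simp only [Set.mem_iUnion, exists_prop, Finset.mem_coe]
      have hff : (v.filter (· ≤ n + 1)).filter (· ≤ n) = v.filter (· ≤ n) := by
        rw [filter_filter]
        refine filter_congr fun x _ => ?_
        by_cases hx : x ≤ n
        · simp [hx, show x ≤ n + 1 by omega]
        · simp [hx]
      constructor
      · rintro ⟨hv, rfl⟩
        rw [show n + (m + 1) = n + 1 + m by ring] at hv
        obtain ⟨L, R, hu, hLR⟩ := exists_eq_insert_max (filter_mem_perms (n := n + 1)
          (by omega) hv.1)
        rw [hff] at hLR
        have hLA : L.length ∈ A := by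
          refine (hav L R hLR).1 fun p hp hc => hv.2 p hp ?_
          obtain ⟨i, j, k, rfl⟩ := hP p hp
          exact contains_three_mono (hu ▸ filter_sublist) hc
        refine ⟨L.length, hLA, hv, ?_⟩
        rw [hu, ← hLR, take_left, drop_left]
      · rintro ⟨p, hp, hv, hu⟩
        rw [show n + 1 + m = n + (m + 1) by ring] at hv
        refine ⟨hv, ?_⟩
        rw [← hff, hu, filter_insert_max (by simpa using hw.1), take_append_drop]
    rw [hU, A.finite_toSet.ncard_biUnion (fun p _ => finite_descendants P _ _ _),
      finsum_mem_coe_finset, ← hF]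
    · refine Finset.sum_congr rfl fun p hp => ih _ _ _ (hins p hp) ?_
      have := hlab _ _ (take_append_drop p w) (by rwa [hlen p hp])
      rwa [hlen p hp] at this
    · intro p hp p' hp' hne
      refine Set.disjoint_left.2 fun v hv hv' => hne ?_
      have e := hv.2.symm.trans hv'.2
      have hw' := notMem_of_mem_perms hw.1
      have := congrArg (idxOf (n + 1)) e
      rw [idxOf_append_of_notMem fun h => hw' ((take_sublist _ _).subset h),
        idxOf_append_of_notMem fun h => hw' ((take_sublist _ _).subset h), idxOf_cons_self,
        idxOf_cons_self, hlen p hp, hlen p' hp'] at this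
      simpa using this

theorem IsGeneratingTree.s_eq {Q : Type*} {P : Set (List ℕ)}
    {Lab : ℕ → Q → List ℕ → Prop} {F : Q → ℕ → ℕ} (h : IsGeneratingTree P Lab F)
    (hP : ∀ p ∈ P, ∃ i j k, p = [i, j, k]) {q : Q} (hq : Lab 1 q [1]) (m : ℕ) :
    s (m + 1) P = F q m := by
  have h1 : [1] ∈ PermsAvoiding 1 P := by
    refine ⟨by simp [Perms], fun p hp hc => ?_⟩
    obtain ⟨i, j, k, rfl⟩ := hP p hp
    obtain ⟨x, y, z, hs, -⟩ := contains_three_iff.1 hc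
    simpa using hs.length_le
  rw [← h.ncard_descendants hP m 1 q [1] h1 hq, s, add_comm]
  congr 1
  ext v
  refine ⟨fun hv => ⟨hv, ?_⟩, fun hv => hv.1⟩
  exact perm_singleton.1 (filter_mem_perms (Nat.le_add_right 1 m) hv.1)

/-! ### The positions where the largest letter may be inserted -/

theorem triple_sublist_insert_iff {x y z M : ℕ} {L R : List ℕ} :
    [x, y, z] <+ L ++ M :: R ↔ [x, y, z] <+ L ++ R ∨ (x = M ∧ [y, z] <+ R) ∨
      (y = M ∧ x ∈ L ∧ z ∈ R) ∨ (z = M ∧ [x, y] <+ L) := by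
  constructor
  · intro h
    obtain ⟨l₁, l₂, e, h₁, h₂⟩ := sublist_append_iff.1 h
    rcases sublist_cons_iff.1 h₂ with h₂ | ⟨r, rfl, h₃⟩
    · exact .inl (e ▸ h₁.append h₂)
    · rcases l₁ with _ | ⟨a, _ | ⟨b, _ | ⟨c, l⟩⟩⟩ <;>
        simp only [nil_append, cons_append, cons.injEq] at e
      · obtain ⟨rfl, rfl⟩ := e
        exact .inr (.inl ⟨rfl, h₃⟩)
      · obtain ⟨rfl, rfl, rfl⟩ := e
        exact .inr (.inr (.inl ⟨rfl, h₁.subset (by simp), h₃.subset (by simp)⟩))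
      · obtain ⟨rfl, rfl, rfl, rfl⟩ := e
        exact .inr (.inr (.inr ⟨rfl, h₁⟩))
      · simp at e
  · rintro (h | ⟨rfl, h⟩ | ⟨rfl, hx, hz⟩ | ⟨rfl, h⟩)
    · exact h.trans ((Sublist.refl L).append (sublist_cons_self M R))
    · exact (h.cons_cons x).trans (sublist_append_right L _)
    · exact (singleton_sublist.2 hx).append ((singleton_sublist.2 hz).cons_cons y)
    · exact h.append (singleton_sublist.2 mem_cons_self)

theorem avoids_insert_iff {n : ℕ} {L R : List ℕ} (i j k : ℕ) (hw : Avoids (L ++ R) [i, j, k]) :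
    Avoids (L ++ (n + 1) :: R) [i, j, k] ↔ ∀ x y z, (x = n + 1 ∧ [y, z] <+ R) ∨
      (y = n + 1 ∧ x ∈ L ∧ z ∈ R) ∨ (z = n + 1 ∧ [x, y] <+ L) →
      ¬ (((x < y ↔ i < j) ∧ (y < x ↔ j < i)) ∧ ((y < z ↔ j < k) ∧ (z < y ↔ k < j)) ∧
        ((x < z ↔ i < k) ∧ (z < x ↔ k < i))) := by
  have hw' := fun h => hw (contains_three_iff.2 h)
  rw [Avoids, contains_three_iff]
  simp only [triple_sublist_insert_iff]
  constructor
  · intro h x y z h1 h2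
    exact h ⟨x, y, z, .inr h1, h2⟩
  · rintro h ⟨x, y, z, h1, h2⟩
    rcases h1 with h1 | h1
    · exact hw' ⟨x, y, z, h1, h2⟩
    · exact h x y z h1 h2

theorem le_and_ne_of_sublist_left {n : ℕ} {L R : List ℕ} (hp : L ++ R ∈ Perms n) {x y : ℕ}
    (h : [x, y] <+ L) : x ≤ n ∧ y ≤ n ∧ x ≠ y :=
  ⟨Perms.le hp (mem_append_left R (h.subset (by simp))),
    Perms.le hp (mem_append_left R (h.subset (by simp))),
    by simpa using (Perms.nodup hp).sublist (h.trans (sublist_append_left L R))⟩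

theorem le_and_ne_of_sublist_right {n : ℕ} {L R : List ℕ} (hp : L ++ R ∈ Perms n) {x y : ℕ}
    (h : [x, y] <+ R) : x ≤ n ∧ y ≤ n ∧ x ≠ y :=
  ⟨Perms.le hp (mem_append_right L (h.subset (by simp))),
    Perms.le hp (mem_append_right L (h.subset (by simp))),
    by simpa using (Perms.nodup hp).sublist (h.trans (sublist_append_right L R))⟩

theorem le_and_ne_of_mem {n : ℕ} {L R : List ℕ} (hp : L ++ R ∈ Perms n) {x y : ℕ}
    (hx : x ∈ L) (hy : y ∈ R) : x ≤ n ∧ y ≤ n ∧ x ≠ y :=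
  ⟨Perms.le hp (mem_append_left R hx), Perms.le hp (mem_append_right L hy),
    (nodup_append.1 (Perms.nodup hp)).2.2 x hx y hy⟩

theorem avoids_insert_123 {n : ℕ} {L R : List ℕ} (hp : L ++ R ∈ Perms n)
    (hw : Avoids (L ++ R) [1, 2, 3]) :
    Avoids (L ++ (n + 1) :: R) [1, 2, 3] ↔ L.Pairwise (· > ·) := by
  rw [avoids_insert_iff _ _ _ hw]
  constructor
  · intro h
    refine pairwise_iff_forall_sublist.2 fun {a b} hab => ?_
    have := h a b (n + 1) (.inr (.inr ⟨rfl, hab⟩))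
    have := le_and_ne_of_sublist_left hp hab
    omega
  · rintro h x y z (⟨rfl, hs⟩ | ⟨rfl, hx, hz⟩ | ⟨rfl, hs⟩)
    · have := le_and_ne_of_sublist_right hp hs
      omega
    · have := le_and_ne_of_mem hp hx hz
      omega
    · have := le_and_ne_of_sublist_left hp hs
      have := pairwise_iff_forall_sublist.1 h hs
      omega

theorem avoids_insert_213 {n : ℕ} {L R : List ℕ} (hp : L ++ R ∈ Perms n)
    (hw : Avoids (L ++ R) [2, 1, 3]) :
    Avoids (L ++ (n + 1) :: R) [2, 1, 3] ↔ L.Pairwise (· < ·) := by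
  rw [avoids_insert_iff _ _ _ hw]
  constructor
  · intro h
    refine pairwise_iff_forall_sublist.2 fun {a b} hab => ?_
    have := h a b (n + 1) (.inr (.inr ⟨rfl, hab⟩))
    have := le_and_ne_of_sublist_left hp hab
    omega
  · rintro h x y z (⟨rfl, hs⟩ | ⟨rfl, hx, hz⟩ | ⟨rfl, hs⟩)
    · have := le_and_ne_of_sublist_right hp hs
      omega
    · have := le_and_ne_of_mem hp hx hz
      omega
    · have := le_and_ne_of_sublist_left hp hs
      have := pairwise_iff_forall_sublist.1 h hs
      omega

theorem avoids_insert_132 {n : ℕ} {L R : List ℕ} (hp : L ++ R ∈ Perms n)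
    (hw : Avoids (L ++ R) [1, 3, 2]) :
    Avoids (L ++ (n + 1) :: R) [1, 3, 2] ↔ ∀ x ∈ L, ∀ y ∈ R, y < x := by
  rw [avoids_insert_iff _ _ _ hw]
  constructor
  · intro h a ha b hb
    have := h a (n + 1) b (.inr (.inl ⟨rfl, ha, hb⟩))
    have := le_and_ne_of_mem hp ha hb
    omega
  · rintro h x y z (⟨rfl, hs⟩ | ⟨rfl, hx, hz⟩ | ⟨rfl, hs⟩)
    · have := le_and_ne_of_sublist_right hp hs
      omega
    · have := le_and_ne_of_mem hp hx hz
      have := h x hx z hz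
      omega
    · have := le_and_ne_of_sublist_left hp hs
      omega

theorem avoids_insert_231 {n : ℕ} {L R : List ℕ} (hp : L ++ R ∈ Perms n)
    (hw : Avoids (L ++ R) [2, 3, 1]) :
    Avoids (L ++ (n + 1) :: R) [2, 3, 1] ↔ ∀ x ∈ L, ∀ y ∈ R, x < y := by
  rw [avoids_insert_iff _ _ _ hw]
  constructor
  · intro h a ha b hb
    have := h a (n + 1) b (.inr (.inl ⟨rfl, ha, hb⟩))
    have := le_and_ne_of_mem hp ha hb
    omega
  · rintro h x y z (⟨rfl, hs⟩ | ⟨rfl, hx, hz⟩ | ⟨rfl, hs⟩)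
    · have := le_and_ne_of_sublist_right hp hs
      omega
    · have := le_and_ne_of_mem hp hx hz
      have := h x hx z hz
      omega
    · have := le_and_ne_of_sublist_left hp hs
      omega

theorem avoids_insert_312 {n : ℕ} {L R : List ℕ} (hp : L ++ R ∈ Perms n)
    (hw : Avoids (L ++ R) [3, 1, 2]) :
    Avoids (L ++ (n + 1) :: R) [3, 1, 2] ↔ R.Pairwise (· > ·) := by
  rw [avoids_insert_iff _ _ _ hw]
  constructor
  · intro h
    refine pairwise_iff_forall_sublist.2 fun {a b} hab => ?_
    have := h (n + 1) a b (.inl ⟨rfl, hab⟩)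
    have := le_and_ne_of_sublist_right hp hab
    omega
  · rintro h x y z (⟨rfl, hs⟩ | ⟨rfl, hx, hz⟩ | ⟨rfl, hs⟩)
    · have := le_and_ne_of_sublist_right hp hs
      have := pairwise_iff_forall_sublist.1 h hs
      omega
    · have := le_and_ne_of_mem hp hx hz
      omega
    · have := le_and_ne_of_sublist_left hp hs
      omega

theorem avoids_insert_321 {n : ℕ} {L R : List ℕ} (hp : L ++ R ∈ Perms n)
    (hw : Avoids (L ++ R) [3, 2, 1]) :
    Avoids (L ++ (n + 1) :: R) [3, 2, 1] ↔ R.Pairwise (· < ·) := by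
  rw [avoids_insert_iff _ _ _ hw]
  constructor
  · intro h
    refine pairwise_iff_forall_sublist.2 fun {a b} hab => ?_
    have := h (n + 1) a b (.inl ⟨rfl, hab⟩)
    have := le_and_ne_of_sublist_right hp hab
    omega
  · rintro h x y z (⟨rfl, hs⟩ | ⟨rfl, hx, hz⟩ | ⟨rfl, hs⟩)
    · have := le_and_ne_of_sublist_right hp hs
      have := pairwise_iff_forall_sublist.1 h hs
      omega
    · have := le_and_ne_of_mem hp hx hz
      omega
    · have := le_and_ne_of_sublist_left hp hs
      omega

/-! ### Splittings of a word after an insertion -/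

theorem append_eq_insert_iff {L R L' R' : List ℕ} {M : ℕ} :
    L' ++ R' = L ++ M :: R ↔ (∃ T, L = L' ++ T ∧ R' = T ++ M :: R) ∨
      ∃ T, L' = L ++ M :: T ∧ R = T ++ R' := by
  rw [append_eq_append_iff]
  constructor
  · rintro (h | ⟨T, rfl, h⟩)
    · exact .inl h
    · rcases cons_eq_append_iff.1 h with ⟨rfl, rfl⟩ | ⟨T, rfl, rfl⟩
      · exact .inl ⟨[], by simp, rfl⟩
      · exact .inr ⟨T, rfl, rfl⟩
  · rintro (h | ⟨T, rfl, rfl⟩)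
    · exact .inl h
    · exact .inr ⟨M :: T, rfl, rfl⟩

theorem increasing_insert_max_iff {n : ℕ} {L T : List ℕ} (h : ∀ x ∈ L ++ T, x ≤ n) :
    (L ++ (n + 1) :: T).Pairwise (· < ·) ↔ L.Pairwise (· < ·) ∧ T = [] := by
  constructor
  · intro h'
    obtain ⟨h1, h2, -⟩ := pairwise_append.1 h'
    refine ⟨h1, eq_nil_iff_forall_not_mem.2 fun x hx => ?_⟩
    have := rel_of_pairwise_cons h2 hx
    have := h x (mem_append_right L hx)
    omega
  · rintro ⟨h1, rfl⟩
    refine pairwise_append.2 ⟨h1, pairwise_singleton _ _, fun x hx y hy => ?_⟩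
    have := h x (mem_append_left [] hx)
    rw [mem_singleton] at hy
    omega

theorem decreasing_insert_max_iff {n : ℕ} {L T : List ℕ} (h : ∀ x ∈ L ++ T, x ≤ n) :
    (L ++ (n + 1) :: T).Pairwise (· > ·) ↔ L = [] ∧ T.Pairwise (· > ·) := by
  constructor
  · intro h'
    obtain ⟨-, h2, h3⟩ := pairwise_append.1 h'
    refine ⟨eq_nil_iff_forall_not_mem.2 fun x hx => ?_, (pairwise_cons.1 h2).2⟩
    have := h3 x hx (n + 1) mem_cons_self
    have := h x (mem_append_left T hx)
    omega
  · rintro ⟨rfl, h2⟩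
    refine pairwise_cons.2 ⟨fun x hx => ?_, h2⟩
    have := h x hx
    omega

theorem gt_insert_max_iff {n : ℕ} {L R T : List ℕ} (h : ∀ x ∈ L ++ T ++ R, x ≤ n) :
    (∀ x ∈ L, ∀ y ∈ T ++ (n + 1) :: R, y < x) ↔ L = [] := by
  constructor
  · intro h'
    refine eq_nil_iff_forall_not_mem.2 fun x hx => ?_
    have := h' x hx (n + 1) (by simp)
    have := h x (by simp [hx])
    omega
  · rintro rfl
    simp

theorem insert_max_gt_iff {n : ℕ} {L R T : List ℕ} (h : ∀ x ∈ L ++ T ++ R, x ≤ n) :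
    (∀ x ∈ L ++ (n + 1) :: T, ∀ y ∈ R, y < x) ↔ ∀ x ∈ L ++ T, ∀ y ∈ R, y < x := by
  have : ∀ y ∈ R, y < n + 1 := fun y hy => Nat.lt_succ_of_le (h y (by simp [hy]))
  simp only [mem_append, mem_cons]
  grind

theorem lt_insert_max_iff {n : ℕ} {L R T : List ℕ} (h : ∀ x ∈ L ++ T ++ R, x ≤ n) :
    (∀ x ∈ L, ∀ y ∈ T ++ (n + 1) :: R, x < y) ↔ ∀ x ∈ L, ∀ y ∈ T ++ R, x < y := by
  have : ∀ y ∈ L, y < n + 1 := fun y hy => Nat.lt_succ_of_le (h y (by simp [hy]))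
  simp only [mem_append, mem_cons]
  grind

theorem insert_max_lt_iff {n : ℕ} {L R T : List ℕ} (h : ∀ x ∈ L ++ T ++ R, x ≤ n) :
    (∀ x ∈ L ++ (n + 1) :: T, ∀ y ∈ R, x < y) ↔ R = [] := by
  constructor
  · intro h'
    refine eq_nil_iff_forall_not_mem.2 fun x hx => ?_
    have := h' (n + 1) (by simp) x hx
    have := h x (by simp [hx])
    omega
  · rintro rfl
    simp

theorem eq_nil_of_length_left {n : ℕ} {L R : List ℕ} (hp : L ++ R ∈ Perms n) :
    L.length = n ↔ R = [] := by
  have := Perms.length_eq hp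
  rw [length_append] at this
  rw [← length_eq_zero_iff]
  omega

/-! ### The trees of single patterns -/

/-- The label is the length of the longest increasing prefix. -/
theorem isGeneratingTree_213 : IsGeneratingTree {[2, 1, 3]}
    (fun n k w => k ≤ n ∧ ∀ L R, L ++ R = w → (L.Pairwise (· < ·) ↔ L.length ≤ k)) ballot where
  zero := ballot_zero_right
  step := by
    rintro n k w ⟨hp, hw⟩ ⟨hk, hl⟩
    simp only [Set.mem_singleton_iff, forall_eq] at hw ⊢
    refine ⟨Finset.range (k + 1), fun p => p + 1, Finset.range_mono (by omega), ?_, ?_,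
      fun m => (ballot_succ k m).symm⟩
    · rintro L R rfl
      rw [avoids_insert_213 hp hw, hl L R rfl, Finset.mem_range, Nat.lt_succ_iff]
    · rintro L R rfl hL
      rw [Finset.mem_range, Nat.lt_succ_iff] at hL
      refine ⟨Nat.succ_le_succ (hL.trans hk), fun L' R' e => ?_⟩
      have hb : ∀ x ∈ L ++ R, x ≤ n := fun x => Perms.le hp
      have hinc := (hl L R rfl).2 hL
      rcases append_eq_insert_iff.1 e with ⟨T, rfl, rfl⟩ | ⟨T, rfl, rfl⟩
      · simp only [(pairwise_append.1 hinc).1, length_append, true_iff]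
        omega
      · rw [increasing_insert_max_iff (fun x hx => hb x (by simp at hx ⊢; tauto)),
          ← length_eq_zero_iff]
        simp only [hinc, true_and, length_append, length_cons]
        omega

/-- The label is the length of the longest decreasing prefix. -/
theorem isGeneratingTree_123 : IsGeneratingTree {[1, 2, 3]}
    (fun n k w => k ≤ n ∧ ∀ L R, L ++ R = w → (L.Pairwise (· > ·) ↔ L.length ≤ k)) ballot where
  zero := ballot_zero_right
  step := by
    rintro n k w ⟨hp, hw⟩ ⟨hk, hl⟩
    simp only [Set.mem_singleton_iff, forall_eq] at hw ⊢
    refine ⟨Finset.range (k + 1), fun p => if p = 0 then k + 1 else p,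
      Finset.range_mono (by omega), ?_, ?_, fun m => ?_⟩
    · rintro L R rfl
      rw [avoids_insert_123 hp hw, hl L R rfl, Finset.mem_range, Nat.lt_succ_iff]
    · rintro L R rfl hL
      rw [Finset.mem_range, Nat.lt_succ_iff] at hL
      beta_reduce
      refine ⟨by split_ifs <;> omega, fun L' R' e => ?_⟩
      have hb : ∀ x ∈ L ++ R, x ≤ n := fun x => Perms.le hp
      have hdec := (hl L R rfl).2 hL
      rcases append_eq_insert_iff.1 e with ⟨T, rfl, rfl⟩ | ⟨T, rfl, rfl⟩
      · simp only [(pairwise_append.1 hdec).1, length_append, true_iff]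
        split_ifs <;> omega
      · rw [decreasing_insert_max_iff (fun x hx => hb x (by simp at hx ⊢; tauto))]
        rcases eq_or_ne L [] with rfl | hne
        · simp [hl T R' rfl]
        · have := length_pos_iff.2 hne
          simp only [hne, false_and, false_iff, length_append, length_cons,
            if_neg this.ne']
          omega
    · rw [ballot_succ, Finset.sum_range_succ', Finset.sum_range_succ]
      simp

/-! ### The trees of pairs of patterns -/

/-- The largest letter can be inserted exactly at the first two positions, as the prefix before it
must be both increasing and decreasing. -/
theorem isGeneratingTree_123_213 : IsGeneratingTree {[1, 2, 3], [2, 1, 3]}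
    (fun n (_ : Unit) _ => 1 ≤ n) (fun _ m => 2 ^ m) where
  zero _ := pow_zero 2
  step := by
    rintro n - w ⟨hp, hw⟩ hn
    simp only [Set.mem_insert_iff, Set.mem_singleton_iff, forall_eq_or_imp, forall_eq] at hw ⊢
    refine ⟨{0, 1}, fun _ => (), ?_, ?_, fun _ _ _ _ => by omega, fun m => ?_⟩
    · intro x
      simp only [Finset.mem_insert, Finset.mem_singleton, Finset.mem_range]
      omega
    · rintro L R rfl
      rw [avoids_insert_123 hp hw.1, avoids_insert_213 hp hw.2]
      rcases L with _ | ⟨a, _ | ⟨b, l⟩⟩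
      · simp
      · simp
      · simp only [pairwise_cons, mem_cons, length_cons, Finset.mem_insert, Finset.mem_singleton]
        refine iff_of_false (fun h => ?_) (by omega)
        have := h.1.1 b (.inl rfl)
        have := h.2.1 b (.inl rfl)
        omega
    · simp [pow_succ']

/-- There are always two admissible positions, `0` and the label `d > 0`. -/
theorem isGeneratingTree_132_213 : IsGeneratingTree {[1, 3, 2], [2, 1, 3]}
    (fun n d w => 0 < d ∧ d ≤ n ∧ ∀ L R, L ++ R = w →
      ((∀ x ∈ L, ∀ y ∈ R, y < x) ∧ L.Pairwise (· < ·) ↔ L.length = 0 ∨ L.length = d))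
    (fun _ m => 2 ^ m) where
  zero _ := pow_zero 2
  step := by
    rintro n d w ⟨hp, hw⟩ ⟨hd, hdn, hl⟩
    simp only [Set.mem_insert_iff, Set.mem_singleton_iff, forall_eq_or_imp, forall_eq] at hw ⊢
    refine ⟨{0, d}, fun p => p + 1, ?_, ?_, ?_, fun m => ?_⟩
    · intro x
      simp only [Finset.mem_insert, Finset.mem_singleton, Finset.mem_range]
      omega
    · rintro L R rfl
      rw [avoids_insert_132 hp hw.1, avoids_insert_213 hp hw.2, hl L R rfl, Finset.mem_insert,
        Finset.mem_singleton]
    · rintro L R rfl hL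
      rw [Finset.mem_insert, Finset.mem_singleton] at hL
      have hlen := Perms.length_eq hp
      rw [length_append] at hlen
      beta_reduce
      refine ⟨by omega, by omega, fun L' R' e => ?_⟩
      have hb : ∀ x ∈ L ++ R, x ≤ n := fun x => Perms.le hp
      have hsite := (hl L R rfl).2 hL
      rcases append_eq_insert_iff.1 e with ⟨T, rfl, rfl⟩ | ⟨T, rfl, rfl⟩
      · rw [gt_insert_max_iff hb, ← length_eq_zero_iff, length_append]
        have := (pairwise_append.1 hsite.2).1
        simp only [this, and_true]
        omega
      · rw [insert_max_gt_iff (fun x hx => hb x (by simpa using hx)),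
          increasing_insert_max_iff (fun x hx => hb x (by simp at hx ⊢; tauto))]
        simp only [length_append, length_cons]
        constructor
        · rintro ⟨-, -, rfl⟩
          simp
        · intro h
          obtain rfl : T = [] := length_eq_zero_iff.1 (by omega)
          simpa using hsite
    · rw [Finset.sum_pair (by omega)]
      ring

/-- The largest letter can be inserted exactly at the two ends. -/
theorem isGeneratingTree_132_231 : IsGeneratingTree {[1, 3, 2], [2, 3, 1]}
    (fun n (_ : Unit) _ => 1 ≤ n) (fun _ m => 2 ^ m) where
  zero _ := pow_zero 2
  step := by
    rintro n - w ⟨hp, hw⟩ hn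
    simp only [Set.mem_insert_iff, Set.mem_singleton_iff, forall_eq_or_imp, forall_eq] at hw ⊢
    refine ⟨{0, n}, fun _ => (), ?_, ?_, fun _ _ _ _ => by omega, fun m => ?_⟩
    · intro x
      simp only [Finset.mem_insert, Finset.mem_singleton, Finset.mem_range]
      omega
    · rintro L R rfl
      rw [avoids_insert_132 hp hw.1, avoids_insert_231 hp hw.2, Finset.mem_insert,
        Finset.mem_singleton, eq_nil_of_length_left hp, length_eq_zero_iff]
      rcases L with _ | ⟨a, l⟩
      · simp
      rcases R with _ | ⟨b, r⟩
      · simp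
      refine iff_of_false (fun h => ?_) (by simp)
      have := h.1 a mem_cons_self b mem_cons_self
      have := h.2 a mem_cons_self b mem_cons_self
      omega
    · rw [Finset.sum_pair (by omega)]
      ring

/-- The labels `inl k`, for the permutations with largest admissible position `k < n`, and
`inr k`, for the increasing permutation of length `k + 1`. -/
theorem isGeneratingTree_213_231 : IsGeneratingTree {[2, 1, 3], [2, 3, 1]}
    (fun n (q : ℕ ⊕ ℕ) w => q.elim
      (fun k => k < n ∧ ∀ L R, L ++ R = w →
        (L.Pairwise (· < ·) ∧ (∀ x ∈ L, ∀ y ∈ R, x < y) ↔ L.length ≤ k))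
      (fun k => n = k + 1 ∧ w.Pairwise (· < ·)))
    (fun q m => q.elim (fun k => (k + m).choose m)
      (fun k => ∑ i ∈ Finset.range (m + 1), (k + m).choose i)) where
  zero := by
    rintro (k | k) <;> simp
  step := by
    -- an insertion that is not at the end leaves only the admissible positions up to itself
    have child : ∀ n L R, L ++ R ∈ Perms n → L.Pairwise (· < ·) → (∀ x ∈ L, ∀ y ∈ R, x < y) →
        L.length < n → ∀ L' R', L' ++ R' = L ++ (n + 1) :: R →
        (L'.Pairwise (· < ·) ∧ (∀ x ∈ L', ∀ y ∈ R', x < y) ↔ L'.length ≤ L.length) := by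
      intro n L R hp hinc hlt hL L' R' e
      have hb : ∀ x ∈ L ++ R, x ≤ n := fun x => Perms.le hp
      have hlen := Perms.length_eq hp
      rw [length_append] at hlen
      rcases append_eq_insert_iff.1 e with ⟨T, rfl, rfl⟩ | ⟨T, rfl, rfl⟩
      · rw [lt_insert_max_iff hb]
        obtain ⟨h1, -, h3⟩ := pairwise_append.1 hinc
        refine iff_of_true ⟨h1, fun x hx y hy => ?_⟩ (by simp)
        rcases mem_append.1 hy with hy | hy
        · exact h3 x hx y hy
        · exact hlt x (mem_append_left T hx) y hy
      · rw [insert_max_lt_iff (fun x hx => hb x (by simpa using hx)),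
          increasing_insert_max_iff (fun x hx => hb x (by simp at hx ⊢; tauto))]
        refine iff_of_false ?_ (by simp)
        rintro ⟨⟨-, rfl⟩, rfl⟩
        simp at hlen
        omega
    rintro n (k | k) w ⟨hp, hw⟩ hlab
    · obtain ⟨hk, hl⟩ := hlab
      simp only [Set.mem_insert_iff, Set.mem_singleton_iff, forall_eq_or_imp, forall_eq] at hw ⊢
      refine ⟨Finset.range (k + 1), .inl, Finset.range_mono (by omega), ?_, ?_, fun m => ?_⟩
      · rintro L R rfl
        rw [avoids_insert_213 hp hw.1, avoids_insert_231 hp hw.2, hl L R rfl, Finset.mem_range,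
          Nat.lt_succ_iff]
      · rintro L R rfl hL
        rw [Finset.mem_range, Nat.lt_succ_iff] at hL
        have hsite := (hl L R rfl).2 hL
        exact ⟨by omega, child n L R hp hsite.1 hsite.2 (by omega)⟩
      · simpa [add_assoc] using Nat.sum_range_add_choose k m
    · obtain ⟨rfl, hinc⟩ := hlab
      simp only [Set.mem_insert_iff, Set.mem_singleton_iff, forall_eq_or_imp, forall_eq] at hw ⊢
      refine ⟨Finset.range (k + 1 + 1), fun p => if p = k + 1 then .inr (k + 1) else .inl p,
        subset_rfl, ?_, ?_, fun m => ?_⟩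
      · rintro L R rfl
        rw [avoids_insert_213 hp hw.1, avoids_insert_231 hp hw.2]
        obtain ⟨h1, -, h3⟩ := pairwise_append.1 hinc
        have hlen := Perms.length_eq hp
        rw [length_append] at hlen
        exact iff_of_true ⟨h1, h3⟩ (by rw [Finset.mem_range]; omega)
      · rintro L R rfl hL
        have hlen := Perms.length_eq hp
        obtain ⟨h1, -, h3⟩ := pairwise_append.1 hinc
        beta_reduce
        by_cases hLk : L.length = k + 1
        · obtain rfl := (eq_nil_of_length_left hp).1 hLk
          rw [if_pos hLk]
          exact ⟨rfl, (increasing_insert_max_iff fun x => Perms.le hp).2 ⟨h1, rfl⟩⟩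
        · rw [if_neg hLk]
          rw [length_append] at hlen
          exact ⟨by omega, child _ L R hp h1 h3 (by omega)⟩
      · rw [Finset.sum_range_succ]
        have : ∀ p ∈ Finset.range (k + 1), ((if p = k + 1 then Sum.inr (k + 1) else Sum.inl p :
            ℕ ⊕ ℕ).elim (fun k => (k + m).choose m)
            (fun k => ∑ i ∈ Finset.range (m + 1), (k + m).choose i)) = (p + m).choose m := by
          intro p hp
          rw [Finset.mem_range] at hp
          rw [if_neg (by omega), Sum.elim_inl]
        beta_reduce
        rw [Finset.sum_congr rfl this, Nat.sum_range_add_choose, if_pos rfl, Sum.elim_inr,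
          Sum.elim_inr, Finset.sum_range_succ _ (m + 1), add_comm,
          show k + 1 + m = k + (m + 1) by ring, show k + m + 1 = k + (m + 1) by ring]

/-- The labels `inl d`, for the permutations with unique admissible position `d < n`, and
`inr n`, for the increasing permutation of length `n`. -/
theorem isGeneratingTree_321_213 : IsGeneratingTree {[3, 2, 1], [2, 1, 3]}
    (fun n (q : ℕ ⊕ ℕ) w => q.elim
      (fun d => d < n ∧ ∀ L R, L ++ R = w →
        (R.Pairwise (· < ·) ∧ L.Pairwise (· < ·) ↔ L.length = d))
      (fun k => n = k ∧ w.Pairwise (· < ·)))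
    (fun q m => q.elim (fun _ => 1) (fun k => 1 + ∑ j ∈ Finset.range m, (k + j))) where
  zero := by
    rintro (k | k) <;> simp
  step := by
    -- after an insertion that is not at the end only the position behind it is admissible
    have child : ∀ n L R, L ++ R ∈ Perms n → R.Pairwise (· < ·) → L.Pairwise (· < ·) →
        L.length < n → ∀ L' R', L' ++ R' = L ++ (n + 1) :: R →
        (R'.Pairwise (· < ·) ∧ L'.Pairwise (· < ·) ↔ L'.length = L.length + 1) := by
      intro n L R hp hR hL hLn L' R' e
      have hb : ∀ x ∈ L ++ R, x ≤ n := fun x => Perms.le hp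
      have hlen := Perms.length_eq hp
      rw [length_append] at hlen
      rcases append_eq_insert_iff.1 e with ⟨T, rfl, rfl⟩ | ⟨T, rfl, rfl⟩
      · rw [increasing_insert_max_iff (fun x hx => hb x (by simp at hx ⊢; tauto))]
        refine iff_of_false ?_ (by simp; omega)
        rintro ⟨⟨-, rfl⟩, -⟩
        simp at hlen hLn
        omega
      · rw [increasing_insert_max_iff (fun x hx => hb x (by simp at hx ⊢; tauto))]
        simp only [length_append, length_cons]
        constructor
        · rintro ⟨-, -, rfl⟩
          simp
        · intro h
          obtain rfl : T = [] := length_eq_zero_iff.1 (by omega)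
          exact ⟨hR, hL, rfl⟩
    rintro n (d | k) w ⟨hp, hw⟩ hlab
    · obtain ⟨hd, hl⟩ := hlab
      simp only [Set.mem_insert_iff, Set.mem_singleton_iff, forall_eq_or_imp, forall_eq] at hw ⊢
      refine ⟨{d}, fun p => .inl (p + 1), by simpa using by omega, ?_, ?_, fun m => by simp⟩
      · rintro L R rfl
        rw [avoids_insert_321 hp hw.1, avoids_insert_213 hp hw.2, hl L R rfl,
          Finset.mem_singleton]
      · rintro L R rfl hL
        rw [Finset.mem_singleton] at hL
        have hsite := (hl L R rfl).2 hL
        exact ⟨by omega, child n L R hp hsite.1 hsite.2 (by omega)⟩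
    · obtain ⟨rfl, hinc⟩ := hlab
      simp only [Set.mem_insert_iff, Set.mem_singleton_iff, forall_eq_or_imp, forall_eq] at hw ⊢
      refine ⟨Finset.range (n + 1), fun p => if p = n then .inr (n + 1) else .inl (p + 1),
        subset_rfl, ?_, ?_, fun m => ?_⟩
      · rintro L R rfl
        rw [avoids_insert_321 hp hw.1, avoids_insert_213 hp hw.2]
        obtain ⟨h1, h2, -⟩ := pairwise_append.1 hinc
        have hlen := Perms.length_eq hp
        rw [length_append] at hlen
        exact iff_of_true ⟨h2, h1⟩ (by rw [Finset.mem_range]; omega)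
      · rintro L R rfl hL
        have hlen := Perms.length_eq hp
        obtain ⟨h1, h2, -⟩ := pairwise_append.1 hinc
        beta_reduce
        by_cases hLk : L.length = n
        · obtain rfl := (eq_nil_of_length_left hp).1 hLk
          rw [if_pos hLk]
          exact ⟨rfl, (increasing_insert_max_iff fun x => Perms.le hp).2 ⟨h1, rfl⟩⟩
        · rw [if_neg hLk]
          rw [length_append] at hlen
          exact ⟨by omega, child _ L R hp h2 h1 (by omega)⟩
      · rw [Finset.sum_range_succ]
        have : ∀ p ∈ Finset.range n, ((if p = n then Sum.inr (n + 1) else Sum.inl (p + 1) :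
            ℕ ⊕ ℕ).elim (fun _ => 1)
            (fun k => 1 + ∑ j ∈ Finset.range m, (k + j))) = 1 := by
          intro p hp
          rw [Finset.mem_range] at hp
          rw [if_neg (by omega), Sum.elim_inl]
        beta_reduce
        rw [Finset.sum_congr rfl this, if_pos rfl, Sum.elim_inr, Sum.elim_inr,
          Finset.sum_range_succ' _ m]
        simp only [Finset.sum_const, Finset.card_range, smul_eq_mul, mul_one, add_zero,
          add_right_comm n 1, add_assoc]
        ring

/-! ### The trees of triples of patterns -/

/-- The label tells whether the first letter is the largest one. -/
theorem isGeneratingTree_123_132_213 : IsGeneratingTree {[1, 2, 3], [1, 3, 2], [2, 1, 3]}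
    (fun n (b : Bool) w => 1 ≤ n ∧ ∀ L R, L ++ R = w →
      (L.Pairwise (· > ·) ∧ (∀ x ∈ L, ∀ y ∈ R, y < x) ∧ L.Pairwise (· < ·) ↔
        L.length = 0 ∨ L.length = 1 ∧ b = true))
    (fun b m => if b then Nat.fib (m + 2) else Nat.fib (m + 1)) where
  zero := by
    rintro (_ | _) <;> simp
  step := by
    rintro n b w ⟨hp, hw⟩ ⟨hn, hl⟩
    simp only [Set.mem_insert_iff, Set.mem_singleton_iff, forall_eq_or_imp, forall_eq] at hw ⊢
    refine ⟨if b then {0, 1} else {0}, fun p => decide (p = 0), ?_, ?_, ?_, fun m => ?_⟩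
    · intro x
      cases b <;> simp <;> omega
    · rintro L R rfl
      rw [avoids_insert_123 hp hw.1, avoids_insert_132 hp hw.2.1, avoids_insert_213 hp hw.2.2,
        hl L R rfl]
      cases b <;> simp
    · rintro L R rfl hL
      refine ⟨by omega, fun L' R' e => ?_⟩
      have hb : ∀ x ∈ L ++ R, x ≤ n := fun x => Perms.le hp
      rcases append_eq_insert_iff.1 e with ⟨T, rfl, rfl⟩ | ⟨T, rfl, rfl⟩
      · rw [gt_insert_max_iff hb]
        simp only [length_append, decide_eq_true_eq, ← length_eq_zero_iff]
        constructor
        · exact fun h => .inl h.2.1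
        · intro h
          obtain rfl : L' = [] := length_eq_zero_iff.1 (by omega)
          simp
      · rw [insert_max_gt_iff (fun x hx => hb x (by simpa using hx)),
          increasing_insert_max_iff (fun x hx => hb x (by simp at hx ⊢; tauto)),
          decreasing_insert_max_iff (fun x hx => hb x (by simp at hx ⊢; tauto))]
        simp only [length_append, length_cons, decide_eq_true_eq]
        constructor
        · rintro ⟨⟨rfl, -⟩, -, -, rfl⟩
          simp
        · intro h
          obtain rfl : T = [] := length_eq_zero_iff.1 (by omega)
          obtain rfl : L = [] := length_eq_zero_iff.1 (by omega)
          simp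
    · cases b
      · simp
      · have : (m + 1 + 2).fib = (m + 1).fib + (m + 2).fib := Nat.fib_add_two
        simp
        omega

/-- The label tells whether the permutation is decreasing. -/
theorem isGeneratingTree_123_132_231 : IsGeneratingTree {[1, 2, 3], [1, 3, 2], [2, 3, 1]}
    (fun n (b : Bool) w => 1 ≤ n ∧ (w.Pairwise (· > ·) ↔ b = true))
    (fun b m => if b then m + 1 else 1) where
  zero := by
    rintro (_ | _) <;> simp
  step := by
    rintro n b w ⟨hp, hw⟩ ⟨hn, hb⟩
    simp only [Set.mem_insert_iff, Set.mem_singleton_iff, forall_eq_or_imp, forall_eq] at hw ⊢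
    have hA : ∀ p, p ∈ (if b then {0, n} else {0} : Finset ℕ) ↔ p = 0 ∨ p = n ∧ b = true := by
      cases b <;> simp
    refine ⟨if b then {0, n} else {0}, fun p => decide (p = 0 ∧ b = true), ?_, ?_, ?_,
      fun m => ?_⟩
    · intro x
      rw [hA, Finset.mem_range]
      omega
    · rintro L R rfl
      rw [avoids_insert_123 hp hw.1, avoids_insert_132 hp hw.2.1, avoids_insert_231 hp hw.2.2,
        hA, eq_nil_of_length_left hp, length_eq_zero_iff, ← hb]
      rcases L with _ | ⟨x, L⟩
      · simp
      rcases R with _ | ⟨y, R⟩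
      · simp
      refine iff_of_false (fun h => ?_) (by simp)
      have := h.2.1 x mem_cons_self y mem_cons_self
      have := h.2.2 x mem_cons_self y mem_cons_self
      omega
    · rintro L R rfl hL
      rw [hA, eq_nil_of_length_left hp] at hL
      have hle : ∀ x ∈ L ++ R, x ≤ n := fun x => Perms.le hp
      refine ⟨by omega, ?_⟩
      rw [decreasing_insert_max_iff hle, decide_eq_true_eq, length_eq_zero_iff, ← hb]
      exact and_congr_right fun h => by rw [h, nil_append]
    · cases b
      · simp
      · rw [if_pos rfl, Finset.sum_pair (by omega)]
        simp [show n ≠ 0 by omega]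

/-- The label tells whether the permutation is increasing. -/
theorem isGeneratingTree_132_213_231 : IsGeneratingTree {[1, 3, 2], [2, 1, 3], [2, 3, 1]}
    (fun n (b : Bool) w => 1 ≤ n ∧ (w.Pairwise (· < ·) ↔ b = true))
    (fun b m => if b then m + 1 else 1) where
  zero := by
    rintro (_ | _) <;> simp
  step := by
    rintro n b w ⟨hp, hw⟩ ⟨hn, hb⟩
    simp only [Set.mem_insert_iff, Set.mem_singleton_iff, forall_eq_or_imp, forall_eq] at hw ⊢
    have hA : ∀ p, p ∈ (if b then {0, n} else {0} : Finset ℕ) ↔ p = 0 ∨ p = n ∧ b = true := by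
      cases b <;> simp
    refine ⟨if b then {0, n} else {0}, fun p => decide (p = n ∧ b = true), ?_, ?_, ?_,
      fun m => ?_⟩
    · intro x
      rw [hA, Finset.mem_range]
      omega
    · rintro L R rfl
      rw [avoids_insert_132 hp hw.1, avoids_insert_213 hp hw.2.1, avoids_insert_231 hp hw.2.2,
        hA, eq_nil_of_length_left hp, length_eq_zero_iff, ← hb]
      rcases L with _ | ⟨x, L⟩
      · simp
      rcases R with _ | ⟨y, R⟩
      · simp
      refine iff_of_false (fun h => ?_) (by simp)
      have := h.1 x mem_cons_self y mem_cons_self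
      have := h.2.2 x mem_cons_self y mem_cons_self
      omega
    · rintro L R rfl hL
      have hle : ∀ x ∈ L ++ R, x ≤ n := fun x => Perms.le hp
      refine ⟨by omega, ?_⟩
      rw [increasing_insert_max_iff hle, decide_eq_true_eq, eq_nil_of_length_left hp, ← hb,
        and_comm]
      exact and_congr_right fun h => by rw [h, append_nil]
    · cases b
      · simp
      · rw [if_pos rfl, Finset.sum_pair (by omega)]
        simp [show 0 ≠ n by omega]
        ring

/-- The label `some k` stands for the decreasing permutation of length `k`, which is the only one
with children. -/
theorem isGeneratingTree_123_132_312 : IsGeneratingTree {[1, 2, 3], [1, 3, 2], [3, 1, 2]}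
    (fun n (q : Option ℕ) w => (w.Pairwise (· > ·) ↔ q.isSome) ∧ ∀ k ∈ q, k = n)
    (fun q m => if m = 0 then 1 else q.elim 0 (· + m)) where
  zero _ := if_pos rfl
  step := by
    rintro n q w ⟨hp, hw⟩ ⟨hdec, hk⟩
    simp only [Set.mem_insert_iff, Set.mem_singleton_iff, forall_eq_or_imp, forall_eq] at hw ⊢
    refine ⟨if q.isSome then Finset.range (n + 1) else ∅,
      fun p => if p = 0 then some (n + 1) else none, ?_, ?_, ?_, fun m => ?_⟩
    · split_ifs <;> simp
    · rintro L R rfl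
      rw [avoids_insert_123 hp hw.1, avoids_insert_132 hp hw.2.1, avoids_insert_312 hp hw.2.2]
      have hlen := Perms.length_eq hp
      rw [length_append] at hlen
      have hmem : L.length ∈ Finset.range (n + 1) := by
        rw [Finset.mem_range]
        omega
      have : L.length ∈ (if q.isSome then Finset.range (n + 1) else ∅) ↔ q.isSome := by
        split_ifs with h <;> simp [h, hmem]
      rw [this, ← hdec, pairwise_append]
      tauto
    · rintro L R rfl hL
      have hle : ∀ x ∈ L ++ R, x ≤ n := fun x => Perms.le hp
      have hq : (L ++ R).Pairwise (· > ·) := by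
        rw [hdec]
        by_contra h
        simp [h] at hL
      rw [decreasing_insert_max_iff hle, ← length_eq_zero_iff]
      by_cases h : L.length = 0
      · simp only [h, if_true]
        exact ⟨by simpa using (pairwise_append.1 hq).2.1, by simp⟩
      · simp [h]
    · rcases q with _ | k
      · simp
      · obtain rfl := hk k rfl
        simp only [Option.isSome_some, if_true, Finset.sum_range_succ']
        rcases m with _ | m
        · simp
        · simp
          ring

/-- The label `none` stands for the decreasing permutation, the label `some d` for a permutation
with unique admissible position `d > 0`. -/
theorem isGeneratingTree_123_231_312 : IsGeneratingTree {[1, 2, 3], [2, 3, 1], [3, 1, 2]}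
    (fun n (q : Option ℕ) w => 1 ≤ n ∧ q.elim (w.Pairwise (· > ·)) fun d => 0 < d ∧ d ≤ n ∧
      ∀ L R, L ++ R = w → (L.Pairwise (· > ·) ∧ (∀ x ∈ L, ∀ y ∈ R, x < y) ∧
        R.Pairwise (· > ·) ↔ L.length = d))
    (fun q m => q.elim (m + 1) fun _ => 1) where
  zero := by
    rintro (_ | _) <;> simp
  step := by
    -- an insertion between two decreasing blocks, the second of which may be empty, leaves the
    -- boundary of the blocks in place as the only admissible position
    have child : ∀ n L R, L ++ R ∈ Perms n → 0 < L.length → L.Pairwise (· > ·) →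
        (∀ x ∈ L, ∀ y ∈ R, x < y) → R.Pairwise (· > ·) →
        ∀ L' R', L' ++ R' = L ++ (n + 1) :: R → (L'.Pairwise (· > ·) ∧
          (∀ x ∈ L', ∀ y ∈ R', x < y) ∧ R'.Pairwise (· > ·) ↔ L'.length = L.length) := by
      intro n L R hp hpos h1 h2 h3 L' R' e
      have hb : ∀ x ∈ L ++ R, x ≤ n := fun x => Perms.le hp
      rcases append_eq_insert_iff.1 e with ⟨T, rfl, rfl⟩ | ⟨T, rfl, rfl⟩
      · rw [lt_insert_max_iff hb,
          decreasing_insert_max_iff (fun x hx => hb x (by simp at hx ⊢; tauto))]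
        constructor
        · rintro ⟨-, -, rfl, -⟩
          simp
        · intro h
          obtain rfl : T = [] := by simpa using h
          rw [append_nil] at h1 h2
          exact ⟨h1, h2, rfl, h3⟩
      · rw [decreasing_insert_max_iff (fun x hx => hb x (by simp at hx ⊢; tauto))]
        refine iff_of_false ?_ (by simp)
        rintro ⟨⟨rfl, -⟩, -⟩
        simp at hpos
    rintro n (_ | d) w ⟨hp, hw⟩ ⟨hn, hlab⟩
    · rw [Option.elim_none] at hlab
      simp only [Set.mem_insert_iff, Set.mem_singleton_iff, forall_eq_or_imp, forall_eq] at hw ⊢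
      refine ⟨{0, n}, fun p => if p = 0 then none else some n, ?_, ?_, ?_, fun m => ?_⟩
      · intro x
        simp only [Finset.mem_insert, Finset.mem_singleton, Finset.mem_range]
        omega
      · rintro L R rfl
        rw [avoids_insert_123 hp hw.1, avoids_insert_231 hp hw.2.1, avoids_insert_312 hp hw.2.2,
          Finset.mem_insert, Finset.mem_singleton, eq_nil_of_length_left hp, length_eq_zero_iff]
        obtain ⟨h1, h2, h3⟩ := pairwise_append.1 hlab
        rcases L with _ | ⟨x, L⟩
        · simpa using h2
        rcases R with _ | ⟨y, R⟩
        · simpa using h1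
        refine iff_of_false (fun h => ?_) (by simp)
        have := h.2.1 x mem_cons_self y mem_cons_self
        have := h3 x mem_cons_self y mem_cons_self
        omega
      · rintro L R rfl hL
        refine ⟨by omega, ?_⟩
        rw [Finset.mem_insert, Finset.mem_singleton, eq_nil_of_length_left hp] at hL
        have hle : ∀ x ∈ L ++ R, x ≤ n := fun x => Perms.le hp
        have hlen := Perms.length_eq hp
        beta_reduce
        by_cases h : L.length = 0
        · rw [if_pos h, Option.elim_none, decreasing_insert_max_iff hle]
          exact ⟨length_eq_zero_iff.1 h, (pairwise_append.1 hlab).2.1⟩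
        · obtain rfl := hL.resolve_left h
          rw [append_nil] at hlab hlen
          rw [if_neg h, Option.elim_some]
          refine ⟨by omega, by omega, ?_⟩
          have := child n L [] hp (by omega) hlab (by simp) .nil
          rwa [hlen] at this
      · rw [Finset.sum_pair (by omega)]
        simp [show n ≠ 0 by omega]
    · obtain ⟨hd, hdn, hl⟩ := hlab
      simp only [Set.mem_insert_iff, Set.mem_singleton_iff, forall_eq_or_imp, forall_eq] at hw ⊢
      refine ⟨{d}, fun p => some p, by simpa using by omega, ?_, ?_, fun m => by simp⟩
      · rintro L R rfl
        rw [avoids_insert_123 hp hw.1, avoids_insert_231 hp hw.2.1, avoids_insert_312 hp hw.2.2,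
          Finset.mem_singleton, hl L R rfl]
      · rintro L R rfl hL
        rw [Finset.mem_singleton] at hL
        obtain ⟨h1, h2, h3⟩ := (hl L R rfl).2 hL
        exact ⟨by omega, by omega, by omega, child n L R hp (by omega) h1 h2 h3⟩

/-! ### Counting permutations that avoid patterns of length three -/

theorem s_213 (m : ℕ) : s (m + 1) {[2, 1, 3]} = catalan (m + 1) := by
  rw [isGeneratingTree_213.s_eq (by simp) (q := 1) ?_, ← ballot_zero_succ, ballot_zero_left]
  refine ⟨le_rfl, fun L R h => ?_⟩
  rcases L with _ | ⟨a, _ | ⟨b, L⟩⟩ <;> simp_all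

theorem s_123 (m : ℕ) : s (m + 1) {[1, 2, 3]} = catalan (m + 1) := by
  rw [isGeneratingTree_123.s_eq (by simp) (q := 1) ?_, ← ballot_zero_succ, ballot_zero_left]
  refine ⟨le_rfl, fun L R h => ?_⟩
  rcases L with _ | ⟨a, _ | ⟨b, L⟩⟩ <;> simp_all

theorem s_312 (m : ℕ) : s (m + 1) {[3, 1, 2]} = catalan (m + 1) := by
  rw [← s_213]
  exact s_eq_of_reverse fun w => by simp [avoids_reverse]

theorem s_321 (m : ℕ) : s (m + 1) {[3, 2, 1]} = catalan (m + 1) := by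
  rw [← s_123]
  exact s_eq_of_reverse fun w => by simp [avoids_reverse]

theorem s_231 (m : ℕ) : s (m + 1) {[2, 3, 1]} = catalan (m + 1) := by
  rw [← s_213]
  refine s_eq_of_compl fun w hw => ?_
  simp [avoids_compl hw (i := 2) (j := 3) (k := 1) (i' := 2) (j' := 1) (k' := 3)]

theorem s_132 (m : ℕ) : s (m + 1) {[1, 3, 2]} = catalan (m + 1) := by
  rw [← s_312]
  refine s_eq_of_compl fun w hw => ?_
  simp [avoids_compl hw (i := 1) (j := 3) (k := 2) (i' := 3) (j' := 1) (k' := 2)]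

theorem s_123_132 (m : ℕ) : s (m + 1) {[1, 2, 3], [1, 3, 2]} = 2 ^ m := by
  rw [← isGeneratingTree_123_213.s_eq (by simp) (q := ()) le_rfl m]
  -- reversal of the word and its complementation together
  trans s (m + 1) {[3, 2, 1], [3, 1, 2]}
  · refine s_eq_of_compl fun w hw => ?_
    simp [avoids_compl hw (i := 1) (j := 3) (k := 2) (i' := 3) (j' := 1) (k' := 2),
      avoids_compl hw (i := 1) (j := 2) (k := 3) (i' := 3) (j' := 2) (k' := 1)]
  · exact s_eq_of_reverse fun w => by simp [avoids_reverse]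

theorem s_132_213 (m : ℕ) : s (m + 1) {[1, 3, 2], [2, 1, 3]} = 2 ^ m := by
  rw [isGeneratingTree_132_213.s_eq (by simp) (q := 1) ?_]
  refine ⟨one_pos, le_rfl, fun L R h => ?_⟩
  rcases L with _ | ⟨a, _ | ⟨b, L⟩⟩ <;> simp_all

theorem s_132_231 (m : ℕ) : s (m + 1) {[1, 3, 2], [2, 3, 1]} = 2 ^ m :=
  isGeneratingTree_132_231.s_eq (by simp) (q := ()) le_rfl m

theorem s_132_312 (m : ℕ) : s (m + 1) {[1, 3, 2], [3, 1, 2]} = 2 ^ m := by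
  trans s (m + 1) {[2, 1, 3], [2, 3, 1]}
  · refine s_eq_of_reverse fun w => ?_
    simp [avoids_reverse, and_comm]
  · rw [isGeneratingTree_213_231.s_eq (by simp) (q := .inr 0) ⟨rfl, pairwise_singleton _ _⟩]
    simpa using Nat.sum_range_choose m

theorem s_123_231 (m : ℕ) : s (m + 1) {[1, 2, 3], [2, 3, 1]} = (m + 1).choose 2 + 1 := by
  trans s (m + 1) {[3, 2, 1], [2, 1, 3]}
  · refine s_eq_of_compl fun w hw => ?_
    simp [avoids_compl hw (i := 2) (j := 3) (k := 1) (i' := 2) (j' := 1) (k' := 3),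
      avoids_compl hw (i := 1) (j := 2) (k := 3) (i' := 3) (j' := 2) (k' := 1)]
  · rw [isGeneratingTree_321_213.s_eq (by simp) (q := .inr 1) ⟨rfl, pairwise_singleton _ _⟩,
      Sum.elim_inr, add_comm, Nat.add_right_cancel_iff]
    induction m with
    | zero => simp
    | succ m ih =>
      rw [Finset.sum_range_succ, ih, Nat.choose_succ_succ' (m + 1) 1, Nat.choose_one_right]
      ring

theorem s_123_132_213 (m : ℕ) :
    s (m + 1) {[1, 2, 3], [1, 3, 2], [2, 1, 3]} = Nat.fib (m + 2) := by
  rw [isGeneratingTree_123_132_213.s_eq (by simp) (q := true) ?_, if_pos rfl]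
  refine ⟨le_rfl, fun L R h => ?_⟩
  rcases L with _ | ⟨a, _ | ⟨b, L⟩⟩ <;> simp_all

theorem s_123_132_231 (m : ℕ) : s (m + 1) {[1, 2, 3], [1, 3, 2], [2, 3, 1]} = m + 1 := by
  rw [isGeneratingTree_123_132_231.s_eq (by simp) (q := true) (by simp), if_pos rfl]

theorem s_132_213_231 (m : ℕ) : s (m + 1) {[1, 3, 2], [2, 1, 3], [2, 3, 1]} = m + 1 := by
  rw [isGeneratingTree_132_213_231.s_eq (by simp) (q := true) (by simp), if_pos rfl]

theorem s_123_132_312 (m : ℕ) : s (m + 1) {[1, 2, 3], [1, 3, 2], [3, 1, 2]} = m + 1 := by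
  rw [isGeneratingTree_123_132_312.s_eq (by simp) (q := some 1) (by simp)]
  split_ifs with h
  · rw [h]
  · simp [add_comm]

theorem s_123_231_312 (m : ℕ) : s (m + 1) {[1, 2, 3], [2, 3, 1], [3, 1, 2]} = m + 1 := by
  rw [isGeneratingTree_123_231_312.s_eq (by simp) (q := none) (by simp), Option.elim_none]

/-! ### Doubling the middle letters of explicit patterns -/

theorem doubleMiddle_insert (i j k : ℕ) (S : Set (List ℕ)) :
    doubleMiddle (insert [i, j, k] S) = insert [i, j, j, k] (doubleMiddle S) := by
  ext p
  simp only [doubleMiddle, Set.mem_ofPred_eq, Set.mem_insert_iff, cons.injEq, and_true]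
  constructor
  · rintro ⟨i', j', k', ⟨rfl, rfl, rfl⟩ | h, rfl⟩
    · exact .inl rfl
    · exact .inr ⟨_, _, _, h, rfl⟩
  · rintro (rfl | ⟨i', j', k', h, rfl⟩)
    · exact ⟨i, j, k, .inl ⟨rfl, rfl, rfl⟩, rfl⟩
    · exact ⟨_, _, _, .inr h, rfl⟩

theorem doubleMiddle_singleton (i j k : ℕ) :
    doubleMiddle {[i, j, k]} = {[i, j, j, k]} := by
  ext p
  simp only [doubleMiddle, Set.mem_ofPred_eq, Set.mem_singleton_iff, cons.injEq, and_true]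
  constructor
  · rintro ⟨i', j', k', ⟨rfl, rfl, rfl⟩, rfl⟩
    rfl
  · rintro rfl
    exact ⟨i, j, k, ⟨rfl, rfl, rfl⟩, rfl⟩

theorem c_doubled_one {n i j k : ℕ} (h : [i, j, k] ∈ Perms 3) :
    c n {[i, j, j, k]} = s n {[i, j, k]} * catalan n := by
  rw [← doubleMiddle_singleton, c_doubleMiddle n (by simpa using h)]

theorem c_doubled_two (n : ℕ) {i j k i' j' k' : ℕ} (h : [i, j, k] ∈ Perms 3)
    (h' : [i', j', k'] ∈ Perms 3) :
    c n {[i, j, j, k], [i', j', j', k']} = s n {[i, j, k], [i', j', k']} * catalan n := by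
  rw [← doubleMiddle_singleton, ← doubleMiddle_insert,
    c_doubleMiddle n (by simpa [Set.insert_subset_iff] using ⟨h, h'⟩)]

theorem c_doubled_three (n : ℕ) {i j k i' j' k' i'' j'' k'' : ℕ} (h : [i, j, k] ∈ Perms 3)
    (h' : [i', j', k'] ∈ Perms 3) (h'' : [i'', j'', k''] ∈ Perms 3) :
    c n {[i, j, j, k], [i', j', j', k'], [i'', j'', j'', k'']} =
      s n {[i, j, k], [i', j', k'], [i'', j'', k'']} * catalan n := by
  rw [← doubleMiddle_singleton, ← doubleMiddle_insert, ← doubleMiddle_insert,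
    c_doubleMiddle n (by simpa [Set.insert_subset_iff] using ⟨h, h', h''⟩)]

theorem s_singleton (m : ℕ) {i j k : ℕ} (h : [i, j, k] ∈ Perms 3) :
    s (m + 1) {[i, j, k]} = catalan (m + 1) := by
  have hr : ∀ x ∈ [i, j, k], 1 ≤ x ∧ x < 1 + 3 := fun x hx => mem_range'_1.1 (h.mem_iff.1 hx)
  obtain ⟨_, _, _, e, hij, hjk, hik⟩ := mem_perms_three h
  simp only [cons.injEq, and_true] at e
  obtain ⟨rfl, rfl, rfl⟩ := e
  simp only [mem_cons, not_mem_nil, or_false, forall_eq_or_imp, forall_eq] at hr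
  obtain ⟨⟨hi, hi'⟩, ⟨hj, hj'⟩, hk, hk'⟩ := hr
  clear h
  interval_cases i <;> interval_cases j <;> first | omega | skip
  all_goals interval_cases k <;> first | omega | skip
  · exact s_123 m
  · exact s_132 m
  · exact s_213 m
  · exact s_231 m
  · exact s_312 m
  · exact s_321 m

theorem perms_three_mem : [1, 2, 3] ∈ Perms 3 ∧ [1, 3, 2] ∈ Perms 3 ∧ [2, 1, 3] ∈ Perms 3 ∧
    [2, 3, 1] ∈ Perms 3 ∧ [3, 1, 2] ∈ Perms 3 := by
  simp only [Perms, Set.mem_ofPred_eq]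
  decide

end NonnestingPattern

theorem mainTheorem1 (n : ℕ) (hn : 1 ≤ n) :
    (∀ S : Set (List ℕ), S ⊆ NonnestingPattern.Perms 3 →
      NonnestingPattern.c n (NonnestingPattern.doubleMiddle S)
        = NonnestingPattern.s n S * catalan n) ∧
    (∀ i j k : ℕ, [i, j, k] ∈ NonnestingPattern.Perms 3 →
      NonnestingPattern.c n {[i, j, j, k]} = catalan n ^ 2) ∧
    (NonnestingPattern.c n {[1, 2, 2, 3], [1, 3, 3, 2]} = 2 ^ (n - 1) * catalan n ∧
      NonnestingPattern.c n {[1, 3, 3, 2], [2, 1, 1, 3]} = 2 ^ (n - 1) * catalan n ∧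
      NonnestingPattern.c n {[1, 3, 3, 2], [2, 3, 3, 1]} = 2 ^ (n - 1) * catalan n ∧
      NonnestingPattern.c n {[1, 3, 3, 2], [3, 1, 1, 2]} = 2 ^ (n - 1) * catalan n) ∧
    NonnestingPattern.c n {[1, 2, 2, 3], [2, 3, 3, 1]} = (n.choose 2 + 1) * catalan n ∧
    NonnestingPattern.c n {[1, 2, 2, 3], [1, 3, 3, 2], [2, 1, 1, 3]}
      = Nat.fib (n + 1) * catalan n ∧
    (NonnestingPattern.c n {[1, 2, 2, 3], [1, 3, 3, 2], [2, 3, 3, 1]} = n * catalan n ∧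
      NonnestingPattern.c n {[1, 3, 3, 2], [2, 1, 1, 3], [2, 3, 3, 1]} = n * catalan n ∧
      NonnestingPattern.c n {[1, 2, 2, 3], [1, 3, 3, 2], [3, 1, 1, 2]} = n * catalan n ∧
      NonnestingPattern.c n {[1, 2, 2, 3], [2, 3, 3, 1], [3, 1, 1, 2]} = n * catalan n ∧
      n * catalan n = (2 * n).choose (n - 1)) := by
  obtain ⟨m, rfl⟩ := Nat.exists_eq_add_of_le' hn
  obtain ⟨h123, h132, h213, h231, h312⟩ := NonnestingPattern.perms_three_mem
  refine ⟨fun S hS => NonnestingPattern.c_doubleMiddle _ hS, fun i j k h => ?_,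
    ⟨?_, ?_, ?_, ?_⟩, ?_, ?_, ?_, ?_, ?_, ?_, NonnestingPattern.mul_catalan_eq_choose hn⟩
  · rw [NonnestingPattern.c_doubled_one h, NonnestingPattern.s_singleton m h, sq]
  · rw [NonnestingPattern.c_doubled_two _ h123 h132, NonnestingPattern.s_123_132,
      Nat.add_sub_cancel]
  · rw [NonnestingPattern.c_doubled_two _ h132 h213, NonnestingPattern.s_132_213,
      Nat.add_sub_cancel]
  · rw [NonnestingPattern.c_doubled_two _ h132 h231, NonnestingPattern.s_132_231,
      Nat.add_sub_cancel]
  · rw [NonnestingPattern.c_doubled_two _ h132 h312, NonnestingPattern.s_132_312,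
      Nat.add_sub_cancel]
  · rw [NonnestingPattern.c_doubled_two _ h123 h231, NonnestingPattern.s_123_231]
  · rw [NonnestingPattern.c_doubled_three _ h123 h132 h213, NonnestingPattern.s_123_132_213]
  · rw [NonnestingPattern.c_doubled_three _ h123 h132 h231, NonnestingPattern.s_123_132_231]
  · rw [NonnestingPattern.c_doubled_three _ h132 h213 h231, NonnestingPattern.s_132_213_231]
  · rw [NonnestingPattern.c_doubled_three _ h123 h132 h312, NonnestingPattern.s_123_132_312]
  · rw [NonnestingPattern.c_doubled_three _ h123 h231 h312, NonnestingPattern.s_123_231_312]
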